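/- **Setting.** For odd $d$ let $\mathbb C^d$ have the orthonormal basis $|n\rangle$, $n\in L_d=\{-\frac{d-1}2,\dots,\frac{d-1}2\}$, and let $\hat H_d=\frac{2\pi}{\sqrt d}\sum_{n\in L_d}n|n\rangle\langle n|$ and $|\theta_k\rangle=\frac1{\sqrt d}\sum_{n\in L_d}e^{-2\pi i kn/d}|n\rangle$ ($k\in L_d$). Let $\theta_3(z,\tau)=\sum_{m\in\mathbb Z}e^{i\pi\tau m^2+2\pi i mz}$. For $\xi^2,\sigma_m^2>0$ and $n_0\in\mathbb Z$ let $$|\Psi_0\rangle=\sum_{k\in L_d}\mathcal N\,\theta_3\!\left(\tfrac kd,\tfrac{i\xi^2}{d}\right)e^{2\pi i n_0k/d}|\theta_k\rangle,\qquad \hat\Omega(x)=\frac{1}{d^{1/4}\sqrt{\theta_3(0,2i\sigma_m^2/d)}}\sum_{k\in L_d}\theta_3\!\left(\tfrac{k-x\sqrt d}{d},\tfrac{i\sigma_m^2}{d}\right)|\theta_k\rangle\langle\theta_k|,$$ where $\mathcal N=\sqrt{2/d}\,\big(\theta_3(0,\tfrac{i\xi^2}{2d})\theta_3(0,\tfrac{id\xi^2}{2})+\theta_3(\tfrac12,\tfrac{i\xi^2}{2d})\theta_3(\tfrac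 d2,\tfrac{id\xi^2}{2})\big)^{-1/2}$ is the normalization constant. The clock is measured $J$ times, the $j$-th measurement coming a time $\delta_j/\sqrt d$ after the preceding one, with $\delta_j=\frac12$ for all $j$. The outcomes $\widetilde\xi_1,\dots,\widetilde\xi_J\in[-\frac{\sqrt d}2,\frac{\sqrt d}2]$ have joint density $$f(\widetilde\xi_1,\dots,\widetilde\xi_J)=\big\|\hat\Omega(\widetilde\xi_J)e^{-i\hat H_d\delta_J/\sqrt d}\cdots\hat\Omega(\widetilde\xi_1)e^{-i\hat H_d\delta_1/\sqrt d}|\Psi_0\rangle\big\|^2 ,$$ and $\langle\cdot\rangle$ is the integral against $f$ over $[-\frac{\sqrt d}2,\frac{\sqrt d}2]^J$. Let $S=\theta_3(\frac1{2d},\frac{i}{2\xi^2d})\theta_3(\frac12,\frac{id}{2\xi^2})+\theta_3(\frac12-\frac1{2d},\frac{i}{2\xi^2d})\theta_3(0,\frac{id}{2\xi^2})$ and $$C_1=\frac{S}{\theta_3(0,\frac{i}{2\xi^2d})\theta_3(0,\frac{id}{2\xi^2})+\theta_3(\frac12,\frac{i}{2\xi^2d})\theta_3(\frac12,\frac{id}{2\xi^2})},\qquad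 C_2=\frac{\theta_3(\frac{i\sigma_m^2}{d},\frac{2i\sigma_m^2}{d})}{\theta_3(0,\frac{2i\sigma_m^2}{d})}e^{-\pi\sigma_m^2/d}.$$ The backaction factor $C_3=C_3(I)$ is the expectation of $\prod_{j=1}^I\big(1-(1-e^{2\pi i\delta_j})\mathbf 1_{p_j=\frac{d-1}2}\big)$ for the random walk $p_1,\dots,p_I$ on $L_d$ (the integers modulo $d$) with initial distribution $p\mapsto\theta_3(\frac{p-n_0+1}d,\frac i{\xi^2d})\,\theta_3(\frac{p-n_0}d,\frac i{\xi^2d})\big/(\frac d2S)$ and jump distribution $q\mapsto\theta_3(\frac qd,\frac i{2\sigma_m^2d})\big/\big(\sqrt{2\sigma_m^2d}\;\theta_3(0,\frac{2i\sigma_m^2}d)\big)$. **Claim.** Let $c_1,c_2,t>0$, $-1<\alpha<1$, $-\frac12<\beta<0$, $\gamma\in(\frac12,1)$, and take $\xi^2=c_1d^\alpha$, $\sigma_m^2=c_2d^\beta$. As $d\to\infty$ through odd integers, uniformly over the integers $n_0$ with $|n_0|<\gamma\frac d2-\frac12$ (which may depend on $d$), the integers $I$ with $2\le I\le t\sqrt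 d$, and the integers $J\ge I$, the following hold. Put $$E_d=d^{\beta/2+1/2}\,e^{-\frac{\pi c_2(1-\gamma)^2}{2t}d^{1/2+\beta}}+d^{-1}\,e^{-\frac{\pi c_1}{4}\left(\gamma-\frac{2|n_0|}d\right)^2d^{1+\alpha}} .$$ 1. $\displaystyle\left\langle\exp\left(-\frac{2\pi i\widetilde\xi_I}{\sqrt d}\right)\right\rangle=e^{-\frac{2\pi i}d\sum_{j=1}^I\delta_j}\;e^{-\frac{\pi c_1}2d^{\alpha-1}-\frac{\pi c_2}2d^{\beta-1}}\Big(1+\mathcal O\big(E_d+e^{-\frac{\pi}{2c_1}d^{1-\alpha}}\big)\Big)$, where $e^{-\frac{2\pi i}d\sum_{j=1}^I\delta_j}=e^{-\pi iI/d}$. 2. $\displaystyle\left\langle\exp\left(-\frac{2\pi i\widetilde\xi_I}{\sqrt d}\right)\right\rangle=e^{-\frac{2\pi i}d\sum_{j=1}^I\delta_j}\,C_1C_2C_3$. 3. $C_3=1+\mathcal O(E_d)$. The implied constants depend only on $c_1,c_2,\alpha,\beta,\gamma,t$. -/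

import Mathlib

open MeasureTheory
open scoped Matrix

noncomputable section

namespace QuasiIdealClock

/-- The labels `-(d-1)/2, …, (d-1)/2` (for odd `d`) of both the energy and the time eigenbasis. -/
abbrev Label (d : ℕ) : Type :=
  ↥(Finset.Icc (-(((d : ℤ) - 1) / 2)) (((d : ℤ) - 1) / 2))

/-- `θ₃(z, i s)` for real `z` and real `s > 0`. It is real, see `theta_ofReal`. -/
def theta (z s : ℝ) : ℝ := (jacobiTheta₂ (z : ℂ) (Complex.I * (s : ℂ))).re

lemma theta_ofReal (z s : ℝ) :
    (theta z s : ℂ) = jacobiTheta₂ (z : ℂ) (Complex.I * (s : ℂ)) := by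
  unfold theta
  apply Complex.conj_eq_iff_re.mp
  rw [jacobiTheta₂_conj]
  simp

/-- The Hamiltonian `H = (2π/√d) ∑ n |n⟩⟨n|`, in the energy eigenbasis. -/
def hamiltonian (d : ℕ) : Matrix (Label d) (Label d) ℂ :=
  Matrix.diagonal fun n => ((2 * Real.pi / Real.sqrt d * ((n : ℤ) : ℝ) : ℝ) : ℂ)

/-- The free evolution `exp(-i τ H)` during a time `τ`. -/
def evolution (d : ℕ) (τ : ℝ) : Matrix (Label d) (Label d) ℂ :=
  NormedSpace.exp ((-(Complex.I * (τ : ℂ))) • hamiltonian d)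

/-- The time eigenstate `|θ_k⟩ = d^{-1/2} ∑ₙ e^{-2πikn/d} |n⟩`. -/
def timeState (d : ℕ) (k : Label d) : Label d → ℂ := fun n =>
  ((1 / Real.sqrt d : ℝ) : ℂ) *
    Complex.exp (-(2 * Real.pi * Complex.I * ((k : ℤ) : ℂ) * ((n : ℤ) : ℂ) / (d : ℂ)))

/-- The coefficient of the initial quasi-ideal state on `|θ_k⟩`. -/
def initialCoeff (d : ℕ) (ξsq : ℝ) (n₀ : ℤ) (k : Label d) : ℂ :=
  ((Real.sqrt (2 / d) /
      Real.sqrt (theta 0 (ξsq / (2 * d)) * theta 0 (d * ξsq / 2) +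
        theta (1 / 2) (ξsq / (2 * d)) * theta (d / 2) (d * ξsq / 2)) *
      theta (((k : ℤ) : ℝ) / d) (ξsq / d) : ℝ) : ℂ) *
    Complex.exp (2 * Real.pi * Complex.I * (n₀ : ℂ) * ((k : ℤ) : ℂ) / (d : ℂ))

/-- The initial quasi-ideal state `|Ψ₀⟩`, of squared width `ξsq` and mean energy label `n₀`. -/
def initialState (d : ℕ) (ξsq : ℝ) (n₀ : ℤ) : Label d → ℂ :=
  ∑ k : Label d, initialCoeff d ξsq n₀ k • timeState d k

/-- The eigenvalue `Ω_k(x)` of the Kraus operator of outcome `x` on `|θ_k⟩`. -/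
def krausCoeff (d : ℕ) (σsq x : ℝ) (k : Label d) : ℝ :=
  1 / Real.sqrt (theta 0 (2 * σsq / d)) * (1 / (d : ℝ) ^ (1 / 4 : ℝ)) *
    theta ((((k : ℤ) : ℝ) - x * Real.sqrt d) / d) (σsq / d)

/-- The Kraus operator `Ω(x) = ∑ₖ Ω_k(x) |θ_k⟩⟨θ_k|` of outcome `x`. -/
def kraus (d : ℕ) (σsq x : ℝ) : Matrix (Label d) (Label d) ℂ :=
  ∑ k : Label d, (krausCoeff d σsq x k : ℂ) •
    Matrix.vecMulVec (timeState d k) (star (timeState d k))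

/-- The unnormalized state after `J` measurements with outcomes `x 0, …, x (J-1)`, where the `j`-th
measurement (`j = 1, …, J`) is preceded by a free evolution during a time `δ j / √d`. -/
def measuredState (d : ℕ) (ξsq σsq : ℝ) (n₀ : ℤ) (δ : ℕ → ℝ) :
    (J : ℕ) → (Fin J → ℝ) → (Label d → ℂ)
  | 0, _ => initialState d ξsq n₀
  | J + 1, x =>
      kraus d σsq (x (Fin.last J)) *ᵥ
        (evolution d (δ (J + 1) / Real.sqrt d) *ᵥ
          measuredState d ξsq σsq n₀ δ J (Fin.init x))

/-- The joint probability density of the `J` outcomes (a squared Euclidean norm). -/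
def outcomeDensity (d : ℕ) (ξsq σsq : ℝ) (n₀ : ℤ) (δ : ℕ → ℝ) (J : ℕ) (x : Fin J → ℝ) : ℝ :=
  ‖WithLp.toLp 2 (measuredState d ξsq σsq n₀ δ J x)‖ ^ 2

/-- The expectation of `exp(-2πi x_i / √d)` over the outcomes of the `J` measurements, each of which
ranges over `[-√d/2, √d/2]`. -/
def clockMoment (d : ℕ) (ξsq σsq : ℝ) (n₀ : ℤ) (δ : ℕ → ℝ) (J : ℕ) (i : Fin J) : ℂ :=
  ∫ x in Set.Icc (fun _ : Fin J => -(Real.sqrt d / 2)) (fun _ : Fin J => Real.sqrt d / 2),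
    Complex.exp (-(2 * Real.pi * Complex.I * ((x i : ℝ) : ℂ) / ((Real.sqrt d : ℝ) : ℂ))) *
      (outcomeDensity d ξsq σsq n₀ δ J x : ℂ)

/-- `θ₃(1/(2d), i/(2ξ²d)) θ₃(1/2, id/(2ξ²)) + θ₃(1/2 - 1/(2d), i/(2ξ²d)) θ₃(0, id/(2ξ²))`. -/
def overlapSum (d : ℕ) (ξsq : ℝ) : ℝ :=
  theta (1 / (2 * d)) (1 / (2 * ξsq * d)) * theta (1 / 2) (d / (2 * ξsq)) +
    theta (1 / 2 - 1 / (2 * d)) (1 / (2 * ξsq * d)) * theta 0 (d / (2 * ξsq))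

/-- The wavefunction factor `C₁`. -/
def waveFactor (d : ℕ) (ξsq : ℝ) : ℝ :=
  overlapSum d ξsq /
    (theta 0 (1 / (2 * ξsq * d)) * theta 0 (d / (2 * ξsq)) +
      theta (1 / 2) (1 / (2 * ξsq * d)) * theta (1 / 2) (d / (2 * ξsq)))

/-- The imprecision factor `C₂ = θ₃(iσ²/d, 2iσ²/d) / θ₃(0, 2iσ²/d) · exp(-πσ²/d)`. -/
def imprecisionFactor (d : ℕ) (σsq : ℝ) : ℂ :=
  jacobiTheta₂ (Complex.I * ((σsq / d : ℝ) : ℂ)) (Complex.I * ((2 * σsq / d : ℝ) : ℂ)) /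
      jacobiTheta₂ 0 (Complex.I * ((2 * σsq / d : ℝ) : ℂ)) *
    Complex.exp (-((Real.pi * σsq / d : ℝ) : ℂ))

/-- The distribution of the first position of the random walk. -/
def walkInitial (d : ℕ) (ξsq : ℝ) (n₀ : ℤ) (p : Label d) : ℝ :=
  theta ((((p : ℤ) - n₀ + 1 : ℤ) : ℝ) / d) (1 / (ξsq * d)) *
      theta ((((p : ℤ) - n₀ : ℤ) : ℝ) / d) (1 / (ξsq * d)) /
    ((d : ℝ) / 2 * overlapSum d ξsq)

/-- The probability of a jump of size `q` of the random walk on the ring of integers mod `d`. -/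
def walkJump (d : ℕ) (σsq : ℝ) (q : ℤ) : ℝ :=
  theta ((q : ℝ) / d) (1 / (2 * σsq * d)) /
    (Real.sqrt (2 * σsq * d) * theta 0 (2 * σsq / d))

/-- The backaction factor `C₃` for the measurement of index `N + 1`: the expectation of
`∏ⱼ (1 - (1 - e^{2πi δⱼ}) 1{pⱼ = (d-1)/2})` over the random walk `p₁, …, p_{N+1}`. -/
def backactionFactor (d : ℕ) (ξsq σsq : ℝ) (n₀ : ℤ) (δ : ℕ → ℝ) (N : ℕ) : ℂ :=
  ∑ p : Fin (N + 1) → Label d,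
    ((walkInitial d ξsq n₀ (p 0) *
        ∏ j : Fin N, walkJump d σsq ((p j.succ : ℤ) - (p j.castSucc : ℤ)) : ℝ) : ℂ) *
      ∏ j : Fin (N + 1),
        (1 - (1 - Complex.exp (2 * Real.pi * Complex.I * (δ ((j : ℕ) + 1) : ℂ))) *
          (if (p j : ℤ) = ((d : ℤ) - 1) / 2 then 1 else 0))

/-- The bound (up to a constant) on the deviation of `C₃` from `1`. -/
def backactionError (c₁ c₂ α β γ t : ℝ) (n₀ : ℤ) (d : ℕ) : ℝ :=
  (d : ℝ) ^ (β / 2 + 1 / 2) *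
      Real.exp (-(Real.pi * c₂ * (1 - γ) ^ 2 / (2 * t)) * (d : ℝ) ^ (1 / 2 + β)) +
    (d : ℝ) ^ (-1 : ℝ) *
      Real.exp (-(Real.pi * c₁ * (γ - 2 * |(n₀ : ℝ)| / d) ^ 2 / 4) * (d : ℝ) ^ (1 + α))

end QuasiIdealClock

end

/-!
In the energy basis the entries of `Ω(x)` are Fourier series in `x / √d`. Integrating out an
outcome `x` against `exp (-2πi j x / √d)` therefore turns the form
`∑ p, a p * conj (ψ p) * ψ (p + i)` of the measured state into one with shift `i + j` of the
unmeasured state, whose weight is `a` convolved with a Gaussian wrapped around `ℤ/d`. For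
`⟨exp (-2πi x_I / √d)⟩` all outcomes after the `I`-th drop out, the `I`-th creates the
shift `1` and the factor `C₂`, and the earlier ones are jumps of a random walk. An evolution step
multiplies the form with shift `1` by a phase, except at the spectral edge
`p = (d - 1) / 2`, where the energy jumps back and an additional `exp (2πi δ)` appears. This gives
the exact factorization, with the initial form producing `C₁`.

`C₃` differs from `1` by at most twice the probability that the walk visits the edge. Since
`p ↦ cosh (r (p + 1/2))` grows in mean by at most a constant factor per jump, that probability is
exponentially small for a walk starting away from the edge. The initial distribution is cut
twice, at `|p| = γ d / 2` and half way from there to the edge: starting points between the two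
cuts are unlikely and still far from the edge, those beyond the second cut are more unlikely
still. `C₁` and `C₂` follow from Poisson summation, which replaces each theta function by one
that is exponentially close to a constant.
-/

noncomputable section

namespace QuasiIdealClock

open Complex (I)
open scoped Real ComplexConjugate FourierTransform

/-! ### Characters of the reals -/

lemma coe_fourierChar_add (x y : ℝ) : (𝐞 (x + y) : ℂ) = 𝐞 x * 𝐞 y := by
  rw [AddChar.map_add_eq_mul, Circle.coe_mul]

lemma coe_fourierChar_neg (x : ℝ) : (𝐞 (-x) : ℂ) = conj (𝐞 x : ℂ) := by
  rw [AddChar.map_neg_eq_inv, Circle.coe_inv_eq_conj]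

lemma coe_fourierChar_zero : (𝐞 0 : ℂ) = 1 := by
  rw [AddChar.map_zero_eq_one, Circle.coe_one]

lemma coe_fourierChar_intCast (n : ℤ) : (𝐞 (n : ℝ) : ℂ) = 1 := by
  rw [Real.fourierChar_apply, Complex.exp_eq_one_iff]
  exact ⟨n, by push_cast; ring⟩

lemma coe_fourierChar_add_intCast (x : ℝ) (n : ℤ) : (𝐞 (x + n) : ℂ) = 𝐞 x := by
  rw [coe_fourierChar_add, coe_fourierChar_intCast, mul_one]

lemma coe_fourierChar_intCast_div_two (n : ℤ) :
    (𝐞 ((n : ℝ) / 2) : ℂ) = if Even n then 1 else -1 := by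
  split_ifs with h
  · obtain ⟨k, rfl⟩ := h.two_dvd
    rw [Int.cast_mul, Int.cast_two, mul_div_cancel_left₀ _ two_ne_zero, coe_fourierChar_intCast]
  · obtain ⟨k, rfl⟩ := Int.not_even_iff_odd.mp h
    rw [show ((2 * k + 1 : ℤ) : ℝ) / 2 = 1 / 2 + (k : ℝ) by push_cast; ring,
      coe_fourierChar_add_intCast, Real.fourierChar_apply,
      show 2 * π * (1 / 2) = π by ring, Complex.exp_pi_mul_I]

lemma continuous_coe_fourierChar : Continuous fun x : ℝ => (𝐞 x : ℂ) :=
  continuous_subtype_val.comp Real.continuous_fourierChar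

/-! ### The theta function -/

lemma theta_eq_cosKernel (z s : ℝ) : theta z s = HurwitzZeta.cosKernel z s := by
  rw [← Complex.ofReal_inj, theta_ofReal, HurwitzZeta.cosKernel_def]

lemma hasSum_theta {s : ℝ} (hs : 0 < s) (z : ℝ) :
    HasSum (fun m : ℤ => ((Real.exp (-(π * s * m ^ 2)) : ℝ) : ℂ) * 𝐞 (m * z))
      (theta z s : ℂ) := by
  rw [theta_eq_cosKernel]
  refine (HurwitzZeta.hasSum_int_cosKernel z hs).congr_fun fun m => ?_
  rw [Real.fourierChar_apply, mul_comm]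
  push_cast
  ring_nf

lemma hasSum_theta_zero {s : ℝ} (hs : 0 < s) :
    HasSum (fun m : ℤ => Real.exp (-(π * s * m ^ 2))) (theta 0 s) := by
  have h := hasSum_theta hs 0
  simp only [mul_zero, coe_fourierChar_zero, mul_one] at h
  exact_mod_cast h

lemma hasSum_exp_neg_sq_add {s : ℝ} (hs : 0 < s) (z : ℝ) :
    HasSum (fun m : ℤ => Real.exp (-(π / s * (m + z) ^ 2))) (√s * theta z s) := by
  have h := HurwitzZeta.hasSum_int_evenKernel z (one_div_pos.mpr hs)
  rw [HurwitzZeta.evenKernel_functional_equation, ← theta_eq_cosKernel, one_div_one_div,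
    Real.div_rpow zero_le_one hs.le, Real.one_rpow, one_div_one_div, ← Real.sqrt_eq_rpow] at h
  refine h.congr_fun fun m => ?_
  ring_nf

lemma exp_neg_sq_le_sqrt_mul_theta {s : ℝ} (hs : 0 < s) (z : ℝ) :
    Real.exp (-(π / s * z ^ 2)) ≤ √s * theta z s := by
  simpa using le_hasSum (hasSum_exp_neg_sq_add hs z) 0 fun _ _ => (Real.exp_pos _).le

lemma sqrt_mul_theta_zero {s : ℝ} (hs : 0 < s) : √s * theta 0 s = theta 0 (1 / s) := by
  refine (hasSum_exp_neg_sq_add hs 0).unique ?_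
  simpa [div_eq_mul_inv] using hasSum_theta_zero (s := 1 / s) (by positivity)

lemma theta_pos {s : ℝ} (hs : 0 < s) (z : ℝ) : 0 < theta z s :=
  pos_of_mul_pos_right ((Real.exp_pos _).trans_le (exp_neg_sq_le_sqrt_mul_theta hs z))
    (Real.sqrt_nonneg s)

lemma norm_exp_mul_fourierChar (a x : ℝ) :
    ‖((Real.exp a : ℝ) : ℂ) * 𝐞 x‖ = Real.exp a := by
  rw [norm_mul, Circle.norm_coe, mul_one, Complex.norm_real,
    Real.norm_of_nonneg (Real.exp_pos _).le]

lemma theta_le_theta_zero {s : ℝ} (hs : 0 < s) (z : ℝ) : theta z s ≤ theta 0 s := by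
  have h := (hasSum_theta hs z).norm_le_of_bounded (hasSum_theta_zero hs) fun m =>
    (norm_exp_mul_fourierChar _ _).le
  exact (le_abs_self _).trans (by simpa using h)

lemma one_le_theta_zero {s : ℝ} (hs : 0 < s) : 1 ≤ theta 0 s := by
  simpa using le_hasSum (hasSum_theta_zero hs) 0 fun _ _ => (Real.exp_pos _).le

lemma abs_theta_sub_one_le {s : ℝ} (hs : 0 < s) (z : ℝ) :
    |theta z s - 1| ≤ theta 0 s - 1 := by
  have hz := (hasSum_theta hs z).sub (hasSum_ite_eq (0 : ℤ) (1 : ℂ))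
  have h0 := (hasSum_theta_zero hs).sub (hasSum_ite_eq (0 : ℤ) (1 : ℝ))
  rw [← Real.norm_eq_abs, ← Complex.norm_real, Complex.ofReal_sub, Complex.ofReal_one]
  refine hz.norm_le_of_bounded h0 fun m => ?_
  split_ifs with hm
  · simp [hm]
  · rw [sub_zero, sub_zero, norm_exp_mul_fourierChar]

lemma theta_neg (z s : ℝ) : theta (-z) s = theta z s := by
  simp [theta, jacobiTheta₂_neg_left]

lemma theta_periodic (s : ℝ) : Function.Periodic (fun z => theta z s) 1 := fun z => by
  simp [theta, jacobiTheta₂_add_left]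

lemma theta_add_intCast (z s : ℝ) (n : ℤ) : theta (z + n) s = theta z s := by
  simpa using (theta_periodic s).int_mul n z

lemma theta_zero_antitoneOn : AntitoneOn (theta 0) (Set.Ioi 0) := fun s hs u hu h => by
  refine hasSum_le (fun m => ?_) (hasSum_theta_zero hu) (hasSum_theta_zero hs)
  gcongr

lemma theta_zero_sub_one_le {s₀ s : ℝ} (hs₀ : 0 < s₀) (h : s₀ ≤ s) :
    theta 0 s - 1 ≤ 2 / (1 - Real.exp (-(π * s₀))) * Real.exp (-(π * s)) := by
  have him : (I * (s : ℂ)).im = s := by simp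
  have hθ : jacobiTheta (I * (s : ℂ)) - 1 = ((theta 0 s - 1 : ℝ) : ℂ) := by
    rw [jacobiTheta_eq_jacobiTheta₂, Complex.ofReal_sub, theta_ofReal]; simp
  have hnorm := norm_jacobiTheta_sub_one_le (τ := I * (s : ℂ)) (by linarith)
  rw [hθ, him, Complex.norm_real, neg_mul] at hnorm
  have : 0 < 1 - Real.exp (-(π * s₀)) :=
    sub_pos.mpr (Real.exp_lt_one_iff.mpr (neg_neg_of_pos (by positivity)))
  refine (Real.le_norm_self _).trans (hnorm.trans ?_)
  gcongr

lemma continuous_theta {s : ℝ} (hs : 0 < s) : Continuous fun z => theta z s := by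
  refine Complex.continuous_re.comp (continuous_iff_continuousAt.mpr fun z => ?_)
  have hθ := continuousAt_jacobiTheta₂ (z : ℂ) (τ := I * (s : ℂ)) (by simpa)
  exact hθ.comp (f := fun z : ℝ => ((z : ℂ), I * (s : ℂ))) (by fun_prop)

/-! ### The labels as residues modulo `d` -/

section Label

variable {d : ℕ}

lemma Label.bounds (hd : Odd d) (p : Label d) : -(d : ℤ) < 2 * (p : ℤ) ∧ 2 * (p : ℤ) < d := by
  obtain ⟨k, rfl⟩ := hd
  have := Finset.mem_Icc.mp p.2
  push_cast at this ⊢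
  omega

/-- The labels as a system of representatives of the integers modulo `d`. -/
def Label.equivZMod (hd : Odd d) : Label d ≃ ZMod d where
  toFun p := ((p : ℤ) : ZMod d)
  invFun a := ⟨a.valMinAbs, by
    have : NeZero d := ⟨hd.pos.ne'⟩
    have := Set.mem_Ioc.mp a.valMinAbs_mem_Ioc
    obtain ⟨k, rfl⟩ := hd
    rw [Finset.mem_Icc]
    push_cast at this ⊢
    omega⟩
  left_inv p := by
    have : NeZero d := ⟨hd.pos.ne'⟩
    have := p.bounds hd
    exact Subtype.ext ((ZMod.valMinAbs_spec _ _).mpr ⟨rfl, by constructor <;> omega⟩)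
  right_inv a := a.coe_valMinAbs

lemma Label.equivZMod_apply (hd : Odd d) (p : Label d) :
    Label.equivZMod hd p = ((p : ℤ) : ZMod d) := rfl

lemma Label.intCast_equivZMod_symm (hd : Odd d) (a : ZMod d) :
    (((Label.equivZMod hd).symm a : ℤ) : ZMod d) = a :=
  (Label.equivZMod hd).apply_symm_apply a

/-- The cyclic shift of the labels by an integer. -/
def Label.shift (hd : Odd d) (i : ℤ) : Label d ≃ Label d :=
  ((Label.equivZMod hd).trans (Equiv.addRight (i : ZMod d))).trans (Label.equivZMod hd).symm

lemma Label.intCast_shift (hd : Odd d) (i : ℤ) (p : Label d) :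
    (((Label.shift hd i p : Label d) : ℤ) : ZMod d) = (p : ℤ) + i :=
  Label.intCast_equivZMod_symm hd _

lemma Label.intCast_inj (hd : Odd d) {p q : Label d} :
    ((p : ℤ) : ZMod d) = (q : ℤ) ↔ p = q :=
  (Label.equivZMod hd).injective.eq_iff

lemma Label.shift_zero (hd : Odd d) (p : Label d) : Label.shift hd 0 p = p := by
  rw [← Label.intCast_inj hd, Label.intCast_shift, Int.cast_zero, add_zero]

lemma eq_of_periodic_of_intCast_eq {M : Type*} {f : ℤ → M} (hf : Function.Periodic f d) {m n : ℤ}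
    (h : (m : ZMod d) = n) : f m = f n := by
  obtain ⟨l, hl⟩ := (ZMod.intCast_eq_intCast_iff_dvd_sub m n d).mp h
  rw [eq_add_of_sub_eq' hl, mul_comm (d : ℤ)]
  exact (hf.int_mul l m).symm

lemma sum_label_add {M : Type*} [AddCommMonoid M] (hd : Odd d) {f : ℤ → M}
    (hf : Function.Periodic f d) (c : ℤ) :
    ∑ p : Label d, f (p + c) = ∑ p : Label d, f p := by
  rw [← (Label.shift hd c).sum_comp fun p => f p]
  exact Finset.sum_congr rfl fun p _ => eq_of_periodic_of_intCast_eq hf (by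
    rw [Label.intCast_shift, Int.cast_add])

/-- Every integer is uniquely a label plus a multiple of `d`. -/
def labelProdIntEquiv (hd : Odd d) : Label d × ℤ ≃ ℤ :=
  Equiv.ofBijective (fun x => x.1 + x.2 * d) <| by
    constructor
    · rintro ⟨p, l⟩ ⟨q, m⟩ h
      obtain rfl : p = q := (Label.intCast_inj hd).mp
        (by simpa using congrArg (Int.cast (R := ZMod d)) h)
      have : (d : ℤ) ≠ 0 := by exact_mod_cast hd.pos.ne'
      simp_all
    · intro m
      obtain ⟨l, hl⟩ := (ZMod.intCast_eq_intCast_iff_dvd_sub _ m d).mp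
        (Label.intCast_equivZMod_symm hd (m : ZMod d))
      exact ⟨((Label.equivZMod hd).symm m, l), by dsimp only; linarith⟩

lemma sum_label_fourierChar (hd : Odd d) (j : ℤ) :
    ∑ k : Label d, (𝐞 (((k : ℤ) : ℝ) * j / d) : ℂ) = if (j : ZMod d) = 0 then (d : ℂ) else 0 := by
  have : NeZero d := ⟨hd.pos.ne'⟩
  have hchar : ∀ k : Label d, (𝐞 (((k : ℤ) : ℝ) * j / d) : ℂ) =
      ZMod.stdAddChar (Label.equivZMod hd k * (j : ZMod d)) := fun k => by
    rw [Label.equivZMod_apply, ← Int.cast_mul (α := ZMod d), ZMod.stdAddChar_coe,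
      Real.fourierChar_apply]
    push_cast
    ring_nf
  rw [Finset.sum_congr rfl fun k _ => hchar k,
    (Label.equivZMod hd).sum_comp fun a => ZMod.stdAddChar (a * (j : ZMod d)),
    AddChar.sum_mulShift _ (ZMod.isPrimitive_stdAddChar d), ZMod.card]
  simp

/-! ### Wrapping functions around the integers modulo `d` -/

/-- The sum of `f` over a residue class modulo `d`, a `d`-periodic function of a representative of
the class. -/
def wrap (d : ℕ) (f : ℤ → ℝ) (q : ℤ) : ℝ := ∑' l : ℤ, f (q + l * d)

lemma wrap_periodic (d : ℕ) (f : ℤ → ℝ) : Function.Periodic (wrap d f) d := fun q => by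
  unfold wrap
  rw [← (Equiv.addLeft (1 : ℤ)).tsum_eq fun l : ℤ => f (q + l * d)]
  refine tsum_congr fun l => ?_
  rw [Equiv.coe_addLeft]
  ring_nf

lemma add_mul_right_injective (hd : 0 < d) (q : ℤ) :
    Function.Injective fun l : ℤ => q + l * d :=
  (add_right_injective q).comp (mul_left_injective₀ (by exact_mod_cast hd.ne'))

lemma sum_label_wrap (hd : Odd d) {f : ℤ → ℝ} (hf : Summable f) :
    ∑ p : Label d, wrap d f p = ∑' m : ℤ, f m := by
  have h : Summable fun x : Label d × ℤ => f (x.1 + x.2 * d) :=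
    (labelProdIntEquiv hd).summable_iff.mpr hf
  rw [← (labelProdIntEquiv hd).tsum_eq, ← tsum_fintype (L := .unconditional _)]
  exact h.tsum_prod.symm

lemma sum_label_wrap_sub (hd : Odd d) {f : ℤ → ℝ} (hf : Summable f) (c : ℤ) :
    ∑ p : Label d, wrap d f (p - c) = ∑' m : ℤ, f m := by
  simp only [sub_eq_add_neg]
  rw [sum_label_add hd (wrap_periodic d f), sum_label_wrap hd hf]

end Label

/-! ### Products of theta functions -/

lemma hasSum_mul_of_summable {ι κ : Type*} {f : ι → ℂ} {g : κ → ℂ} {a b : ℂ} (hf : HasSum f a)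
    (hg : HasSum g b) : HasSum (fun m : ι × κ => f m.1 * g m.2) (a * b) :=
  hf.mul hg (summable_mul_of_summable_norm hf.summable.norm hg.summable.norm)

lemma hasSum_theta_mul_theta {s u : ℝ} (hs : 0 < s) (hu : 0 < u) (x y : ℝ) :
    HasSum (fun m : ℤ × ℤ => ((Real.exp (-(π * s * m.1 ^ 2) + -(π * u * m.2 ^ 2)) : ℝ) : ℂ) *
      𝐞 (m.1 * x + m.2 * y)) (theta x s * theta y u : ℂ) := by
  refine (hasSum_mul_of_summable (hasSum_theta hs x) (hasSum_theta hu y)).congr_fun fun m => ?_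
  rw [Real.exp_add, coe_fourierChar_add]
  push_cast
  ring

lemma hasSum_sum_label_theta_mul_theta {d : ℕ} (hd : Odd d) {s u : ℝ} (hs : 0 < s) (hu : 0 < u)
    (w : ℝ) :
    HasSum (fun m : ℤ × ℤ =>
        (d : ℂ) * (((Real.exp (-(π * s * (d * m.1 - m.2) ^ 2) + -(π * u * m.2 ^ 2)) : ℝ) : ℂ) *
          𝐞 (m.2 * w)))
      (∑ p : Label d, (theta (((p : ℤ) : ℝ) / d) s * theta (((p : ℤ) : ℝ) / d + w) u : ℂ)) := by
  have h := hasSum_sum (s := Finset.univ) fun (p : Label d) _ =>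
    hasSum_theta_mul_theta hs hu (((p : ℤ) : ℝ) / d) (((p : ℤ) : ℝ) / d + w)
  have hterm : ∀ m : ℤ × ℤ, ∑ p : Label d,
      ((Real.exp (-(π * s * m.1 ^ 2) + -(π * u * m.2 ^ 2)) : ℝ) : ℂ) *
        𝐞 (m.1 * (((p : ℤ) : ℝ) / d) + m.2 * (((p : ℤ) : ℝ) / d + w)) =
      ((Real.exp (-(π * s * m.1 ^ 2) + -(π * u * m.2 ^ 2)) : ℝ) : ℂ) * 𝐞 (m.2 * w) *
        if ((m.1 + m.2 : ℤ) : ZMod d) = 0 then (d : ℂ) else 0 := fun m => by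
    rw [← sum_label_fourierChar hd, Finset.mul_sum]
    refine Finset.sum_congr rfl fun p _ => ?_
    rw [show m.1 * (((p : ℤ) : ℝ) / d) + m.2 * (((p : ℤ) : ℝ) / d + w) =
      m.2 * w + ((p : ℤ) : ℝ) * (m.1 + m.2 : ℤ) / d by push_cast; ring, coe_fourierChar_add]
    ring
  have hinj : Function.Injective fun m : ℤ × ℤ => ((d : ℤ) * m.1 - m.2, m.2) := by
    rintro ⟨l, m⟩ ⟨l', m'⟩ h
    have hd₀ : (d : ℤ) ≠ 0 := by exact_mod_cast hd.pos.ne'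
    simp only [Prod.mk.injEq] at h
    obtain ⟨h, rfl⟩ := h
    rw [mul_left_cancel₀ hd₀ (sub_left_injective h)]
  simp only [hterm] at h
  rw [← hinj.hasSum_iff] at h
  · refine h.congr_fun fun m => ?_
    simp
    ring
  · rintro ⟨m, m'⟩ hm
    rw [if_neg, mul_zero]
    rw [ZMod.intCast_zmod_eq_zero_iff_dvd]
    rintro ⟨l, hl⟩
    exact hm ⟨(l, m'), by simp [← hl]⟩

lemma hasSum_theta_mul_theta_add_half {s u : ℝ} (hs : 0 < s) (hu : 0 < u) (x y : ℝ) {k : ℤ}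
    (hk : Odd k) :
    HasSum (fun m : ℤ × ℤ => (2 : ℂ) *
        (((Real.exp (-(π * s * m.1 ^ 2) + -(π * u * (k * m.1 - 2 * m.2) ^ 2)) : ℝ) : ℂ) *
          𝐞 (m.1 * x + (k * m.1 - 2 * m.2) * y)))
      (theta x s * theta y u + theta (x + 1 / 2) s * theta (y + 1 / 2) u : ℂ) := by
  have h := (hasSum_theta_mul_theta hs hu x y).add
    (hasSum_theta_mul_theta hs hu (x + 1 / 2) (y + 1 / 2))
  obtain ⟨j, rfl⟩ := hk
  have hterm : ∀ m : ℤ × ℤ,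
      ((Real.exp (-(π * s * m.1 ^ 2) + -(π * u * m.2 ^ 2)) : ℝ) : ℂ) * 𝐞 (m.1 * x + m.2 * y) +
      ((Real.exp (-(π * s * m.1 ^ 2) + -(π * u * m.2 ^ 2)) : ℝ) : ℂ) *
        𝐞 (m.1 * (x + 1 / 2) + m.2 * (y + 1 / 2)) =
      ((Real.exp (-(π * s * m.1 ^ 2) + -(π * u * m.2 ^ 2)) : ℝ) : ℂ) * 𝐞 (m.1 * x + m.2 * y) *
        (1 + if Even (m.1 + m.2) then 1 else -1) := fun m => by
    rw [← coe_fourierChar_intCast_div_two, show m.1 * (x + 1 / 2) + m.2 * (y + 1 / 2) =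
      m.1 * x + m.2 * y + (m.1 + m.2 : ℤ) / 2 by push_cast; ring,
      coe_fourierChar_add (m.1 * x + m.2 * y)]
    ring
  have hinj : Function.Injective fun m : ℤ × ℤ => (m.1, (2 * j + 1) * m.1 - 2 * m.2) := by
    rintro ⟨l, m⟩ ⟨l', m'⟩ h
    simp only [Prod.mk.injEq] at h
    obtain ⟨rfl, h⟩ := h
    rw [Prod.mk.injEq]
    exact ⟨rfl, by omega⟩
  simp only [hterm] at h
  rw [← hinj.hasSum_iff] at h
  · refine h.congr_fun fun m => ?_
    have heven : Even (m.1 + ((2 * j + 1) * m.1 - 2 * m.2)) :=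
      ⟨(j + 1) * m.1 - m.2, by ring⟩
    simp only [Function.comp, if_pos heven]
    push_cast
    ring
  · rintro ⟨l, m⟩ hm
    rw [if_neg, add_neg_cancel, mul_zero]
    rintro ⟨c, hc⟩
    refine hm ⟨(l, (j + 1) * l - c), ?_⟩
    rw [Prod.mk.injEq]
    exact ⟨rfl, by linear_combination -hc⟩

lemma sum_label_theta_mul_theta {d : ℕ} (hd : Odd d) {s : ℝ} (hs : 0 < s) (w : ℝ) :
    ∑ p : Label d, theta (((p : ℤ) : ℝ) / d) s * theta (((p : ℤ) : ℝ) / d + w) s =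
      d / 2 * (theta (d * w / 2) (d ^ 2 * s / 2) * theta (w / 2) (s / 2) +
        theta (d * w / 2 + 1 / 2) (d ^ 2 * s / 2) * theta (1 / 2 - w / 2) (s / 2)) := by
  have : (0 : ℝ) < d := by exact_mod_cast hd.pos
  have hlabel := hasSum_sum_label_theta_mul_theta hd hs hs w
  have hhalf := (hasSum_theta_mul_theta_add_half (s := d ^ 2 * s / 2) (u := s / 2)
    (by positivity) (by positivity) (d * w / 2) (-(w / 2)) (k := d) (by exact_mod_cast hd)).mul_left
      ((d : ℂ) / 2)
  rw [show (1 : ℝ) / 2 - w / 2 = -(w / 2) + 1 / 2 by ring, ← theta_neg (w / 2)]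
  have huniq := hlabel.unique (hhalf.congr_fun fun m => by
    have hexp : -(π * s * (d * m.1 - m.2) ^ 2) + -(π * s * m.2 ^ 2) =
        -(π * (d ^ 2 * s / 2) * m.1 ^ 2) + -(π * (s / 2) * ((d : ℤ) * m.1 - 2 * m.2) ^ 2) := by
      push_cast; ring
    have hphase : (m.2 : ℝ) * w = m.1 * (d * w / 2) + ((d : ℤ) * m.1 - 2 * m.2) * -(w / 2) := by
      push_cast; ring
    rw [hexp, hphase]
    ring)
  apply Complex.ofReal_injective
  push_cast
  exact huniq

/-! ### Duplication formulas -/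

lemma theta_zero_add_theta_half {s : ℝ} (hs : 0 < s) :
    theta 0 s + theta (1 / 2) s = 2 * (√(1 / (4 * s)) * theta 0 (1 / (4 * s))) := by
  have h := (hasSum_theta hs 0).add (hasSum_theta hs (1 / 2))
  have hdual := hasSum_exp_neg_sq_add (s := 1 / (4 * s)) (by positivity) 0
  have hinj : Function.Injective fun l : ℤ => 2 * l := fun a b h => by simpa using h
  simp only [mul_zero, coe_fourierChar_zero, mul_one_div, coe_fourierChar_intCast_div_two,
    ← mul_add] at h
  rw [← hinj.hasSum_iff] at h
  · have huniq := h.unique ((Complex.hasSum_ofReal.mpr (hdual.mul_left 2)).congr_fun fun l => by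
      have hexp : -(π / (1 / (4 * s)) * (l + 0) ^ 2) = -(π * s * ((2 * l : ℤ) : ℝ) ^ 2) := by
        push_cast; field_simp; ring
      simp only [Function.comp, if_pos (even_two_mul l), hexp]
      push_cast
      ring)
    exact_mod_cast huniq
  · intro m hm
    rw [if_neg fun heven => hm (heven.exists_two_nsmul.imp fun a ha => by simpa using ha.symm)]
    simp

lemma theta_zero_sub_theta_half {s : ℝ} (hs : 0 < s) :
    theta 0 s - theta (1 / 2) s = 2 * (√(1 / (4 * s)) * theta (1 / 2) (1 / (4 * s))) := by
  have h := (hasSum_theta hs 0).sub (hasSum_theta hs (1 / 2))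
  have hdual := hasSum_exp_neg_sq_add (s := 1 / (4 * s)) (by positivity) (1 / 2)
  have hinj : Function.Injective fun l : ℤ => 2 * l + 1 := fun a b h => by simpa using h
  simp only [mul_zero, coe_fourierChar_zero, mul_one_div, coe_fourierChar_intCast_div_two,
    ← mul_sub] at h
  rw [← hinj.hasSum_iff] at h
  · have huniq := h.unique ((Complex.hasSum_ofReal.mpr (hdual.mul_left 2)).congr_fun fun l => by
      have hexp : -(π / (1 / (4 * s)) * (l + 1 / 2) ^ 2) =
          -(π * s * ((2 * l + 1 : ℤ) : ℝ) ^ 2) := by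
        push_cast; field_simp; ring
      simp only [Function.comp, if_neg (Int.not_even_iff_odd.mpr ⟨l, rfl⟩), hexp]
      push_cast
      ring)
    exact_mod_cast huniq
  · intro m hm
    rw [if_pos (Int.not_odd_iff_even.mp fun ⟨a, ha⟩ => hm ⟨a, ha.symm⟩), sub_self, mul_zero]

/-! ### Gaussians wrapped around the integers modulo `d` -/

/-- The Gaussian `exp (-a m²)` on the integers. -/
def gauss (a : ℝ) (m : ℤ) : ℝ := Real.exp (-(a * m ^ 2))

lemma gauss_pos (a : ℝ) (m : ℤ) : 0 < gauss a m := Real.exp_pos _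

lemma hasSum_gauss {a : ℝ} (ha : 0 < a) : HasSum (gauss a) (theta 0 (a / π)) := by
  have h := hasSum_theta_zero (s := a / π) (by positivity)
  rwa [mul_div_cancel₀ a Real.pi_ne_zero] at h

lemma summable_wrap_gauss {a : ℝ} (ha : 0 < a) {d : ℕ} (hd : 0 < d) (q : ℤ) :
    Summable fun l : ℤ => gauss a (q + l * d) :=
  (hasSum_gauss ha).summable.comp_injective (add_mul_right_injective hd q)

lemma wrap_gauss_pos {a : ℝ} (ha : 0 < a) {d : ℕ} (hd : 0 < d) (q : ℤ) :
    0 < wrap d (gauss a) q :=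
  (summable_wrap_gauss ha hd q).tsum_pos (fun _ => (gauss_pos _ _).le) 0 (gauss_pos _ _)

lemma wrap_gauss {a : ℝ} (ha : 0 < a) {d : ℕ} (hd : 0 < d) (q : ℤ) :
    wrap d (gauss a) q = √(π / (a * d ^ 2)) * theta (q / d) (π / (a * d ^ 2)) := by
  have : (0 : ℝ) < d := by exact_mod_cast hd
  rw [← (hasSum_exp_neg_sq_add (s := π / (a * d ^ 2)) (by positivity) (q / d)).tsum_eq]
  refine tsum_congr fun l => ?_
  rw [gauss]
  congr 1
  push_cast
  field_simp
  ring

lemma hasSum_gauss_sub_mul_exp {a : ℝ} (ha : 0 < a) (c : ℤ) (x r : ℝ) :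
    HasSum (fun m : ℤ => gauss a (m - c) * Real.exp (r * (m + x)))
      (Real.exp (r ^ 2 / (4 * a)) * Real.exp (r * (c + x)) *
        (√(π / a) * theta (-c - r / (2 * a)) (π / a))) := by
  refine ((hasSum_exp_neg_sq_add (s := π / a) (by positivity) (-c - r / (2 * a))).mul_left
    _).congr_fun fun m => ?_
  rw [gauss, ← Real.exp_add, ← Real.exp_add, ← Real.exp_add]
  congr 1
  push_cast
  field_simp
  ring

lemma tsum_gauss_sub_mul_exp_le {a : ℝ} (ha : 0 < a) (c : ℤ) (x r : ℝ) :
    ∑' m : ℤ, gauss a (m - c) * Real.exp (r * (m + x)) ≤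
      Real.exp (r ^ 2 / (4 * a)) * Real.exp (r * (c + x)) * theta 0 (a / π) := by
  have hdual : √(π / a) * theta 0 (π / a) = theta 0 (a / π) := by
    have h := hasSum_exp_neg_sq_add (s := π / a) (by positivity) 0
    simp only [add_zero, div_div_cancel₀ Real.pi_ne_zero] at h
    exact h.unique (hasSum_gauss ha)
  rw [(hasSum_gauss_sub_mul_exp ha c x r).tsum_eq, ← hdual]
  have := theta_le_theta_zero (s := π / a) (by positivity) (-c - r / (2 * a))
  gcongr

lemma gauss_sub_mul_cosh (a : ℝ) (c : ℤ) (x r : ℝ) (m : ℤ) :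
    gauss a (m - c) * Real.cosh (r * (m + x)) =
      (gauss a (m - c) * Real.exp (r * (m + x)) + gauss a (m - c) * Real.exp (-r * (m + x))) /
        2 := by
  rw [Real.cosh_eq, neg_mul]
  ring

lemma summable_gauss_sub_mul_cosh {a : ℝ} (ha : 0 < a) (c : ℤ) (x r : ℝ) :
    Summable fun m : ℤ => gauss a (m - c) * Real.cosh (r * (m + x)) := by
  simp only [gauss_sub_mul_cosh]
  exact ((hasSum_gauss_sub_mul_exp ha c x r).summable.add
    (hasSum_gauss_sub_mul_exp ha c x (-r)).summable).div_const 2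

lemma tsum_gauss_sub_mul_cosh_le {a : ℝ} (ha : 0 < a) (c : ℤ) (x r : ℝ) :
    ∑' m : ℤ, gauss a (m - c) * Real.cosh (r * (m + x)) ≤
      Real.exp (r ^ 2 / (4 * a)) * Real.cosh (r * (c + x)) * theta 0 (a / π) := by
  simp only [gauss_sub_mul_cosh]
  rw [tsum_div_const, (hasSum_gauss_sub_mul_exp ha c x r).summable.tsum_add
    (hasSum_gauss_sub_mul_exp ha c x (-r)).summable, Real.cosh_eq]
  have hpos := tsum_gauss_sub_mul_exp_le ha c x r
  have hneg := tsum_gauss_sub_mul_exp_le ha c x (-r)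
  rw [neg_sq, neg_mul] at hneg
  linarith

lemma Label.abs_add_le_abs_add_mul {d : ℕ} (hd : Odd d) (q : Label d) (l : ℤ) {x : ℝ}
    (hx : |2 * x| ≤ 1) : |((q : ℤ) : ℝ) + x| ≤ |(((q : ℤ) + l * d : ℤ) : ℝ) + x| := by
  have hq : |2 * ((q : ℤ) : ℝ)| + 1 ≤ d := by
    have := q.bounds hd
    have : |2 * (q : ℤ)| + 1 ≤ d := by rw [Int.add_one_le_iff, abs_lt]; exact ⟨by omega, by omega⟩
    exact_mod_cast this
  obtain rfl | hl := eq_or_ne l 0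
  · simp
  have hld : (d : ℝ) ≤ |(l : ℝ) * d| := by
    rw [abs_mul, Nat.abs_cast]
    exact le_mul_of_one_le_left (Nat.cast_nonneg d) (by exact_mod_cast Int.one_le_abs hl)
  have htri := abs_sub_abs_le_abs_add ((l : ℝ) * d) (((q : ℤ) : ℝ) + x)
  have hadd := abs_add_le (2 * ((q : ℤ) : ℝ)) (2 * x)
  rw [← mul_add, abs_mul, abs_two] at hadd
  rw [Int.cast_add, Int.cast_mul, Int.cast_natCast, add_comm ((q : ℤ) : ℝ) (l * d), add_assoc]
  linarith

lemma sum_wrap_gauss_sub_mul_cosh_le {a : ℝ} (ha : 0 < a) {d : ℕ} (hd : Odd d) (c : ℤ) {x : ℝ}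
    (hx : |2 * x| ≤ 1) (r : ℝ) :
    ∑ q : Label d, wrap d (gauss a) (q - c) * Real.cosh (r * ((q : ℤ) + x)) ≤
      Real.exp (r ^ 2 / (4 * a)) * Real.cosh (r * (c + x)) * theta 0 (a / π) := by
  set f : ℤ → ℝ := fun m => gauss a (m - c) * Real.cosh (r * (m + x)) with hf
  have hsum : Summable f := summable_gauss_sub_mul_cosh ha c x r
  calc _ ≤ ∑ q : Label d, wrap d f q := Finset.sum_le_sum fun q _ => ?_
    _ = ∑' m : ℤ, f m := sum_label_wrap hd hsum
    _ ≤ _ := tsum_gauss_sub_mul_cosh_le ha c x r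
  rw [wrap, ← tsum_mul_right]
  refine Summable.tsum_le_tsum (fun l => ?_) ((summable_wrap_gauss ha hd.pos _).mul_right _)
    (hsum.comp_injective (add_mul_right_injective hd.pos q))
  have hcosh : Real.cosh (r * ((q : ℤ) + x)) ≤
      Real.cosh (r * (((q : ℤ) + l * d : ℤ) + x)) := by
    rw [Real.cosh_le_cosh, abs_mul, abs_mul]
    exact mul_le_mul_of_nonneg_left (Label.abs_add_le_abs_add_mul hd q l hx) (abs_nonneg r)
  simp only [hf, add_sub_right_comm (q : ℤ) (l * d) c]
  exact mul_le_mul_of_nonneg_left hcosh (gauss_pos _ _).le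

/-! ### Fourier series on an interval -/

section Fourier

variable {L : ℝ} {A B : ℤ → ℂ} {f g h : ℝ → ℂ}

lemma setIntegral_fourierChar (hL : 0 < L) (n : ℤ) :
    ∫ x in Set.Icc (-(L / 2)) (L / 2), (𝐞 (n * (x / L)) : ℂ) = if n = 0 then (L : ℂ) else 0 := by
  rw [integral_Icc_eq_integral_Ioc, ← intervalIntegral.integral_of_le (by linarith)]
  split_ifs with hn
  · simp [hn]
  · have hrate : (2 * π * I * n / L : ℂ) ≠ 0 :=
      div_ne_zero (mul_ne_zero Complex.two_pi_I_ne_zero (by exact_mod_cast hn))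
        (by exact_mod_cast hL.ne')
    have hexp : ∀ x : ℝ, (𝐞 (n * (x / L)) : ℂ) = Complex.exp ((2 * π * I * n / L : ℂ) * x) :=
      fun x => by rw [Real.fourierChar_apply]; congr 1; push_cast; ring
    simp only [hexp]
    rw [integral_exp_mul_complex hrate, ← hexp, ← hexp,
      show (n : ℝ) * (L / 2 / L) = n * (-(L / 2) / L) + n by field_simp; ring,
      coe_fourierChar_add_intCast, sub_self, zero_div]

lemma hasSum_integral_mul_fourierChar {μ : Measure ℝ} (hg : Integrable g μ) (hB : Summable B)
    (hh : ∀ x, HasSum (fun m => B m * 𝐞 (-(m * (x / L)))) (h x)) :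
    HasSum (fun m => B m * ∫ x, g x * 𝐞 (-(m * (x / L))) ∂μ) (∫ x, g x * h x ∂μ) := by
  have htsum : ∀ x, ∑' m : ℤ, B m * (g x * 𝐞 (-(m * (x / L)))) = g x * h x := fun x => by
    rw [← ((hh x).mul_left (g x)).tsum_eq]
    exact tsum_congr fun m => mul_left_comm _ _ _
  have hsum := hasSum_integral_of_summable_integral_norm (μ := μ)
    (F := fun (m : ℤ) x => B m * (g x * 𝐞 (-(m * (x / L)))))
    (fun m => (hg.mul_bdd (c := 1)
      (continuous_coe_fourierChar.comp (by fun_prop)).aestronglyMeasurable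
      (.of_forall fun x => (Circle.norm_coe _).le)).const_mul _)
    (by
      simp only [norm_mul, Circle.norm_coe, mul_one, integral_const_mul]
      exact hB.norm.mul_right _)
  simpa only [integral_const_mul, htsum] using hsum

lemma setIntegral_fourierChar_mul (hL : 0 < L) (hA : Summable A)
    (hf : ∀ x, HasSum (fun m => A m * 𝐞 (-(m * (x / L)))) (f x)) (k : ℤ) :
    ∫ x in Set.Icc (-(L / 2)) (L / 2), 𝐞 (k * (x / L)) * f x = L * A k := by
  have hchar : Continuous fun x : ℝ => (𝐞 (k * (x / L)) : ℂ) :=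
    continuous_coe_fourierChar.comp (by fun_prop)
  refine (hasSum_integral_mul_fourierChar hchar.integrableOn_Icc hA hf).unique ?_
  have hcoeff : ∀ m : ℤ, ∫ x in Set.Icc (-(L / 2)) (L / 2),
      (𝐞 (k * (x / L)) * 𝐞 (-(m * (x / L))) : ℂ) = if k - m = 0 then (L : ℂ) else 0 := fun m => by
    rw [← setIntegral_fourierChar hL]
    refine integral_congr_ae (.of_forall fun x => ?_)
    dsimp only
    rw [← coe_fourierChar_add, Int.cast_sub, sub_mul, sub_eq_add_neg]
  simp only [hcoeff, sub_eq_zero]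
  convert hasSum_ite_eq k (L * A k : ℂ) using 2 with m
  obtain rfl | hm := eq_or_ne m k
  · rw [if_pos rfl, if_pos rfl, mul_comm]
  · rw [if_neg hm, if_neg hm.symm, mul_zero]

/- Expand `h` and then read off the Fourier coefficients of `f`. -/
lemma hasSum_setIntegral_conj_mul_mul_fourierChar (hL : 0 < L) (hA : Summable A) (hB : Summable B)
    (hfc : Continuous f)
    (hf : ∀ x, HasSum (fun m => A m * 𝐞 (-(m * (x / L)))) (f x))
    (hh : ∀ x, HasSum (fun m => B m * 𝐞 (-(m * (x / L)))) (h x)) (j : ℤ) :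
    HasSum (fun m => L * (conj (A m) * B (m - j)))
      (∫ x in Set.Icc (-(L / 2)) (L / 2), conj (f x) * h x * 𝐞 (-(j * (x / L)))) := by
  have hchar : Continuous fun x : ℝ => (𝐞 (-(j * (x / L))) : ℂ) :=
    continuous_coe_fourierChar.comp (by fun_prop)
  have hcoeff : ∀ m : ℤ, ∫ x in Set.Icc (-(L / 2)) (L / 2),
      conj (f x) * 𝐞 (-(j * (x / L))) * 𝐞 (-(m * (x / L))) = L * conj (A (m + j)) := fun m => by
    rw [← Complex.conj_ofReal L, ← map_mul, ← setIntegral_fourierChar_mul hL hA hf,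
      ← integral_conj]
    refine integral_congr_ae (.of_forall fun x => ?_)
    dsimp only
    rw [map_mul, ← coe_fourierChar_neg, mul_assoc, ← coe_fourierChar_add, mul_comm]
    congr 3
    push_cast
    ring
  have hint : IntegrableOn (fun x => conj (f x) * 𝐞 (-(j * (x / L))))
      (Set.Icc (-(L / 2)) (L / 2)) :=
    ((Complex.continuous_conj.comp hfc).mul hchar).integrableOn_Icc
  have hsum := hasSum_integral_mul_fourierChar hint hB hh
  simp only [hcoeff] at hsum
  rw [← (Equiv.subRight j).hasSum_iff] at hsum
  simp only [mul_right_comm] at hsum ⊢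
  refine hsum.congr_fun fun m => ?_
  simp only [Function.comp, Equiv.subRight_apply, sub_add_cancel]
  ring

end Fourier

lemma hasSum_ite_intCast_eq {d : ℕ} (hd : 0 < d) {f : ℤ → ℝ} (hf : Summable f) (q : ℤ) :
    HasSum (fun m : ℤ => if (m : ZMod d) = q then f m else 0) (wrap d f q) := by
  have hinj := add_mul_right_injective hd q
  rw [← hinj.hasSum_iff]
  · refine (hf.comp_injective hinj).hasSum.congr_fun fun l => ?_
    simp
  · intro m hm
    refine if_neg fun h => ?_
    obtain ⟨l, hl⟩ := (ZMod.intCast_eq_intCast_iff_dvd_sub q m d).mp h.symm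
    exact hm ⟨l, by dsimp only; linarith⟩

/-! ### The Kraus operators -/

section Kraus

variable {d : ℕ} {σsq : ℝ}

/-- The normalization constant `d^{-1/4} θ₃(0, 2iσ²/d)^{-1/2}` of the Kraus operators. -/
def krausNorm (d : ℕ) (σsq : ℝ) : ℝ :=
  1 / √(theta 0 (2 * σsq / d)) * (1 / (d : ℝ) ^ (1 / 4 : ℝ))

lemma sqrt_mul_krausNorm_sq (hd : 0 < d) (hσ : 0 < σsq) :
    √d * krausNorm d σsq ^ 2 = 1 / theta 0 (2 * σsq / d) := by
  have hd₀ : (0 : ℝ) < d := by exact_mod_cast hd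
  have hroot : ((d : ℝ) ^ (1 / 4 : ℝ)) ^ 2 = √d := by
    rw [← Real.rpow_natCast, ← Real.rpow_mul hd₀.le, Real.sqrt_eq_rpow]
    norm_num
  have hθ := theta_pos (s := 2 * σsq / d) (by positivity) 0
  have : √(d : ℝ) ≠ 0 := (Real.sqrt_pos.mpr hd₀).ne'
  rw [krausNorm, mul_pow, div_pow, div_pow, hroot, Real.sq_sqrt hθ.le]
  field_simp

lemma timeState_mul_conj (d : ℕ) (k n n' : Label d) :
    timeState d k n * conj (timeState d k n') =
      1 / d * 𝐞 (((k : ℤ) : ℝ) * (((n' : ℤ) - n : ℤ) : ℝ) / d) := by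
  have hstate : ∀ m : Label d, timeState d k m =
      ((1 / √d : ℝ) : ℂ) * 𝐞 (-(((k : ℤ) : ℝ) * ((m : ℤ) : ℝ) / d)) := fun m => by
    rw [timeState, Real.fourierChar_apply]
    congr 2
    push_cast
    ring
  have hnorm : ((1 / √d : ℝ) : ℂ) * ((1 / √d : ℝ) : ℂ) = 1 / d := by
    rw [← Complex.ofReal_mul, div_mul_div_comm, Real.mul_self_sqrt (Nat.cast_nonneg d)]
    push_cast
    ring
  rw [hstate, hstate, map_mul, Complex.conj_ofReal, ← coe_fourierChar_neg, neg_neg,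
    mul_mul_mul_comm, hnorm, ← coe_fourierChar_add]
  congr 3
  push_cast
  ring

lemma kraus_apply (d : ℕ) (σsq x : ℝ) (n n' : Label d) :
    kraus d σsq x n n' = ∑ k : Label d,
      (krausCoeff d σsq x k : ℂ) * (timeState d k n * conj (timeState d k n')) := by
  rw [kraus, Matrix.sum_apply]
  exact Finset.sum_congr rfl fun k _ => by
    rw [Matrix.smul_apply, Matrix.vecMulVec_apply, smul_eq_mul, Pi.star_apply, Complex.star_def]

lemma continuous_kraus (hd : 0 < d) (hσ : 0 < σsq) : Continuous (kraus d σsq) := by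
  have : (0 : ℝ) < d := by exact_mod_cast hd
  have hcoeff : ∀ k, Continuous fun x => krausCoeff d σsq x k := fun k =>
    continuous_const.mul ((continuous_theta (by positivity)).comp (by fun_prop))
  exact continuous_finsetSum _ fun k _ =>
    (Complex.continuous_ofReal.comp (hcoeff k)).smul continuous_const

lemma continuous_kraus_apply (hd : 0 < d) (hσ : 0 < σsq) (n n' : Label d) :
    Continuous fun x => kraus d σsq x n n' :=
  (continuous_kraus hd hσ).matrix_elem n n'

/-- The Fourier coefficients, in `x / √d`, of the entries `⟨n|Ω(x)|n'⟩` with `n - n' = r`. -/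
def krausFourier (d : ℕ) (σsq : ℝ) (r : ZMod d) (m : ℤ) : ℝ :=
  if (m : ZMod d) = r then krausNorm d σsq * gauss (π * (σsq / d)) m else 0

lemma summable_gauss_kraus (hd : 0 < d) (hσ : 0 < σsq) : Summable (gauss (π * (σsq / d))) := by
  have : (0 : ℝ) < d := by exact_mod_cast hd
  exact (hasSum_gauss (by positivity)).summable

lemma summable_krausFourier (hd : 0 < d) (hσ : 0 < σsq) (r : ZMod d) :
    Summable fun m => (krausFourier d σsq r m : ℂ) :=
  Complex.summable_ofReal.mpr <|
    (((summable_gauss_kraus hd hσ).mul_left (krausNorm d σsq)).indicator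
      {m : ℤ | (m : ZMod d) = r}).congr fun m => by
        rw [Set.indicator_apply, krausFourier]; rfl

lemma sum_timeState_mul_conj_mul_fourierChar (hd : Odd d) (n n' : Label d) (m : ℤ) :
    ∑ k : Label d, timeState d k n * conj (timeState d k n') * 𝐞 (((k : ℤ) : ℝ) * m / d) =
      if (m : ZMod d) = (n : ℤ) - (n' : ℤ) then 1 else 0 := by
  have hd₀ : (d : ℂ) ≠ 0 := by exact_mod_cast hd.pos.ne'
  have hterm : ∀ k : Label d,
      timeState d k n * conj (timeState d k n') * 𝐞 (((k : ℤ) : ℝ) * m / d) =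
        1 / d * 𝐞 (((k : ℤ) : ℝ) * ((m - (n - n') : ℤ) : ℝ) / d) := fun k => by
    rw [timeState_mul_conj, mul_assoc, ← coe_fourierChar_add]
    congr 3
    push_cast
    ring
  simp only [hterm, ← Finset.mul_sum, sum_label_fourierChar hd, Int.cast_sub (R := ZMod d),
    sub_eq_zero, mul_ite, one_div_mul_cancel hd₀, mul_zero]

lemma hasSum_kraus (hd : Odd d) (hσ : 0 < σsq) (x : ℝ) (n n' : Label d) :
    HasSum (fun m : ℤ => (krausFourier d σsq ((n : ℤ) - (n' : ℤ)) m : ℂ) * 𝐞 (-(m * (x / √d))))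
      (kraus d σsq x n n') := by
  have : (0 : ℝ) < d := by exact_mod_cast hd.pos
  have h := hasSum_sum (s := Finset.univ) fun (k : Label d) _ =>
    (hasSum_theta (s := σsq / d) (by positivity) ((((k : ℤ) : ℝ) - x * √d) / d)).mul_left
      ((krausNorm d σsq : ℂ) * (timeState d k n * conj (timeState d k n')))
  have hkraus : ∑ k : Label d, (krausNorm d σsq : ℂ) *
      (timeState d k n * conj (timeState d k n')) *
        (theta ((((k : ℤ) : ℝ) - x * √d) / d) (σsq / d) : ℂ) = kraus d σsq x n n' := by
    rw [kraus_apply]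
    refine Finset.sum_congr rfl fun k _ => ?_
    rw [krausCoeff, ← krausNorm]
    push_cast
    ring
  rw [hkraus] at h
  refine h.congr_fun fun m => ?_
  have hphase : ∀ k : Label d, (m : ℝ) * ((((k : ℤ) : ℝ) - x * √d) / d) =
      -(m * (x / √d)) + ((k : ℤ) : ℝ) * m / d := fun k => by
    rw [sub_div, mul_div_assoc x, Real.sqrt_div_self', mul_one_div]
    ring
  calc _ = (krausNorm d σsq * gauss (π * (σsq / d)) m : ℂ) * 𝐞 (-(m * (x / √d))) *
        ∑ k : Label d, timeState d k n * conj (timeState d k n') *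
          𝐞 (((k : ℤ) : ℝ) * m / d) := by
        rw [sum_timeState_mul_conj_mul_fourierChar hd, krausFourier]
        split_ifs
        · push_cast
          ring
        · simp
    _ = _ := by
        rw [Finset.mul_sum]
        refine Finset.sum_congr rfl fun k _ => ?_
        rw [hphase, coe_fourierChar_add, gauss]
        ring

/-- The normalized product `m ↦ g(m) g(m - j)` of the Fourier coefficients `g` of the Kraus
operators with their translate by `j`. -/
def krausProd (d : ℕ) (σsq : ℝ) (j m : ℤ) : ℝ :=
  gauss (π * (σsq / d)) m * gauss (π * (σsq / d)) (m - j) / theta 0 (2 * σsq / d)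

lemma summable_krausProd (hd : 0 < d) (hσ : 0 < σsq) (j : ℤ) : Summable (krausProd d σsq j) := by
  have hle : ∀ m : ℤ, gauss (π * (σsq / d)) (m - j) ≤ 1 := fun m => by
    rw [gauss, Real.exp_le_one_iff, neg_nonpos]
    positivity
  exact (Summable.of_nonneg_of_le (fun m => (mul_pos (gauss_pos _ _) (gauss_pos _ _)).le)
    (fun m => mul_le_of_le_one_right (gauss_pos _ _).le (hle m))
    (summable_gauss_kraus hd hσ)).div_const _

lemma setIntegral_kraus (hd : Odd d) (hσ : 0 < σsq) (i j : ℤ) (p n n' : Label d) :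
    ∫ x in Set.Icc (-(√d / 2)) (√d / 2), conj (kraus d σsq x p n) *
        kraus d σsq x (Label.shift hd i p) n' * 𝐞 (-(j * (x / √d))) =
      if n' = Label.shift hd (i + j) n then (wrap d (krausProd d σsq j) (p - n) : ℂ) else 0 := by
  have hd₀ : 0 < √(d : ℝ) := Real.sqrt_pos.mpr (by exact_mod_cast hd.pos)
  have h := hasSum_setIntegral_conj_mul_mul_fourierChar hd₀ (summable_krausFourier hd.pos hσ _)
    (summable_krausFourier hd.pos hσ _) (continuous_kraus_apply hd.pos hσ p n)
    (fun x => hasSum_kraus hd hσ x p n) (fun x => hasSum_kraus hd hσ x (Label.shift hd i p) n') j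
  have hn' : n' = Label.shift hd (i + j) n ↔
      ((n' : ℤ) : ZMod d) = (n : ℤ) + (i + j) := by
    rw [← Label.intCast_inj hd, Label.intCast_shift, Int.cast_add]
  have hterm : ∀ m : ℤ, (√d * (conj (krausFourier d σsq ((p : ℤ) - (n : ℤ)) m : ℂ) *
      krausFourier d σsq (((Label.shift hd i p : Label d) : ℤ) - (n' : ℤ)) (m - j)) : ℂ) =
      if n' = Label.shift hd (i + j) n then
        ((if (m : ZMod d) = (p - n : ℤ) then krausProd d σsq j m else 0 : ℝ) : ℂ) else 0 :=
    fun m => by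
      have hcongr (hm : (m : ZMod d) = (p : ℤ) - (n : ℤ)) :
          ((m - j : ℤ) : ZMod d) = ((p : ℤ) + i - (n' : ℤ)) ↔ n' = Label.shift hd (i + j) n := by
        rw [hn', Int.cast_sub, hm]
        constructor <;> intro h <;> linear_combination h
      rw [Complex.conj_ofReal, krausFourier, krausFourier, Label.intCast_shift,
        Int.cast_sub (p : ℤ)]
      by_cases hm : (m : ZMod d) = (p : ℤ) - (n : ℤ)
      · simp only [if_pos hm, hcongr hm]
        split_ifs
        · rw [krausProd, div_eq_mul_one_div (gauss _ _ * _), ← sqrt_mul_krausNorm_sq hd.pos hσ]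
          push_cast
          ring
        · simp
      · simp [hm]
  simp only [hterm] at h
  refine h.unique ?_
  split_ifs
  · exact Complex.hasSum_ofReal.mpr
      (hasSum_ite_intCast_eq hd.pos (summable_krausProd hd.pos hσ j) _)
  · exact hasSum_zero

lemma krausProd_zero (d : ℕ) (σsq : ℝ) (m : ℤ) :
    krausProd d σsq 0 m = gauss (2 * π * σsq / d) m / theta 0 (2 * σsq / d) := by
  rw [krausProd, gauss, gauss, gauss, ← Real.exp_add, sub_zero]
  ring_nf

lemma walkJump_eq_wrap_gauss (hd : 0 < d) (hσ : 0 < σsq) (q : ℤ) :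
    walkJump d σsq q = wrap d (gauss (2 * π * σsq / d)) q / theta 0 (2 * σsq / d) := by
  have : (0 : ℝ) < d := by exact_mod_cast hd
  rw [wrap_gauss (by positivity) hd, walkJump,
    show π / (2 * π * σsq / d * (d : ℝ) ^ 2) = 1 / (2 * σsq * d) by field_simp,
    Real.sqrt_div zero_le_one, Real.sqrt_one]
  ring

lemma wrap_krausProd_zero (hd : 0 < d) (hσ : 0 < σsq) (q : ℤ) :
    wrap d (krausProd d σsq 0) q = walkJump d σsq q := by
  simp only [walkJump_eq_wrap_gauss hd hσ, wrap, krausProd_zero, tsum_div_const]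

lemma tsum_krausProd_zero (hd : 0 < d) (hσ : 0 < σsq) : ∑' m : ℤ, krausProd d σsq 0 m = 1 := by
  have : (0 : ℝ) < d := by exact_mod_cast hd
  have h := hasSum_gauss (a := 2 * π * σsq / d) (by positivity)
  rw [show 2 * π * σsq / d / π = 2 * σsq / d by field_simp] at h
  simp only [krausProd_zero, tsum_div_const, h.tsum_eq]
  exact div_self (theta_pos (by positivity) _).ne'

lemma tsum_krausProd_one (hd : 0 < d) (hσ : 0 < σsq) :
    ((∑' m : ℤ, krausProd d σsq 1 m : ℝ) : ℂ) = imprecisionFactor d σsq := by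
  have : (0 : ℝ) < d := by exact_mod_cast hd
  have : (d : ℂ) ≠ 0 := by exact_mod_cast hd.ne'
  have h := hasSum_jacobiTheta₂_term (I * ((σsq / d : ℝ) : ℂ))
    (τ := I * ((2 * σsq / d : ℝ) : ℂ)) (by rw [Complex.I_mul_im, Complex.ofReal_re]; positivity)
  have hθ := theta_ofReal 0 (2 * σsq / d)
  rw [Complex.ofReal_zero] at hθ
  rw [imprecisionFactor, ← hθ, div_mul_eq_mul_div, ← h.tsum_eq, ← tsum_mul_right, ← tsum_div_const,
    Complex.ofReal_tsum, ← (Equiv.neg ℤ).tsum_eq]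
  refine tsum_congr fun m => ?_
  rw [krausProd, gauss, gauss, Equiv.neg_apply, ← Real.exp_add, jacobiTheta₂_term,
    ← Complex.exp_add, Complex.ofReal_div, Complex.ofReal_exp]
  congr 2
  push_cast
  field_simp
  linear_combination (-(2 * (m : ℂ) ^ 2 + 2 * m) * σsq) * Complex.I_sq

end Kraus

/-! ### Weighted cyclic shifts under measurement and evolution -/

section ShiftForm

variable {d : ℕ} {σsq : ℝ}

/-- The expectation, in the vector `ψ`, of the cyclic shift by `i` of the energy labels weighted by
`a`. Integrating over a measurement outcome maps such quadratic forms to each other. -/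
def shiftForm (hd : Odd d) (i : ℤ) (a ψ : Label d → ℂ) : ℂ :=
  ∑ p : Label d, a p * (conj (ψ p) * ψ (Label.shift hd i p))

lemma continuous_shiftForm (hd : Odd d) (i : ℤ) (a : Label d → ℂ) :
    Continuous (shiftForm hd i a) := by
  unfold shiftForm
  fun_prop

lemma shiftForm_const_mul (hd : Odd d) (i : ℤ) (c : ℂ) (a ψ : Label d → ℂ) :
    shiftForm hd i (fun p => c * a p) ψ = c * shiftForm hd i a ψ := by
  simp only [shiftForm, Finset.mul_sum, mul_assoc]

lemma norm_sq_eq_shiftForm (hd : Odd d) (ψ : Label d → ℂ) :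
    ((‖WithLp.toLp 2 ψ‖ ^ 2 : ℝ) : ℂ) = shiftForm hd 0 (fun _ => 1) ψ := by
  rw [EuclideanSpace.norm_sq_eq, Complex.ofReal_sum]
  refine Finset.sum_congr rfl fun p _ => ?_
  rw [Label.shift_zero, one_mul, Complex.conj_mul', Complex.ofReal_pow]

lemma shiftForm_mulVec (hd : Odd d) (i : ℤ) (a φ : Label d → ℂ)
    (M : Matrix (Label d) (Label d) ℂ) :
    shiftForm hd i a (M *ᵥ φ) = ∑ n : Label d, ∑ p : Label d, ∑ n' : Label d,
      a p * conj (φ n) * φ n' * (conj (M p n) * M (Label.shift hd i p) n') := by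
  rw [Finset.sum_comm]
  refine Finset.sum_congr rfl fun p _ => ?_
  simp only [Matrix.mulVec, dotProduct, map_sum, map_mul]
  rw [Finset.sum_mul_sum, Finset.mul_sum]
  refine Finset.sum_congr rfl fun n _ => ?_
  rw [Finset.mul_sum]
  exact Finset.sum_congr rfl fun n' _ => by ring

lemma setIntegral_shiftForm_kraus (hd : Odd d) (hσ : 0 < σsq) (i j : ℤ) (a φ : Label d → ℂ) :
    ∫ x in Set.Icc (-(√d / 2)) (√d / 2),
        shiftForm hd i a (kraus d σsq x *ᵥ φ) * 𝐞 (-(j * (x / √d))) =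
      shiftForm hd (i + j)
        (fun n => ∑ p : Label d, (wrap d (krausProd d σsq j) (p - n) : ℂ) * a p) φ := by
  have hint : ∀ p n n', IntegrableOn (fun x => a p * conj (φ n) * φ n' *
      (conj (kraus d σsq x p n) * kraus d σsq x (Label.shift hd i p) n' * 𝐞 (-(j * (x / √d)))))
      (Set.Icc (-(√d / 2)) (√d / 2)) := fun p n n' =>
    (continuous_const.mul
      (((Complex.continuous_conj.comp (continuous_kraus_apply hd.pos hσ p n)).mul
        (continuous_kraus_apply hd.pos hσ _ n')).mul
          (continuous_coe_fourierChar.comp (by fun_prop)))).integrableOn_Icc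
  simp only [shiftForm_mulVec, Finset.sum_mul, mul_assoc (_ * _ : ℂ) (conj _ * _)]
  rw [integral_finsetSum _ fun n _ => integrable_finsetSum _ fun p _ =>
    integrable_finsetSum _ fun n' _ => hint p n n', shiftForm]
  refine Finset.sum_congr rfl fun n _ => ?_
  rw [integral_finsetSum _ fun p _ => integrable_finsetSum _ fun n' _ => hint p n n',
    Finset.sum_mul]
  refine Finset.sum_congr rfl fun p _ => ?_
  rw [integral_finsetSum _ fun n' _ => hint p n n']
  simp only [integral_const_mul, setIntegral_kraus hd hσ, mul_ite, mul_zero, Finset.sum_ite_eq',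
    Finset.mem_univ, if_true]
  ring

lemma evolution_mulVec (hd : 0 < d) (τ : ℝ) (φ : Label d → ℂ) (p : Label d) :
    (evolution d (τ / √d) *ᵥ φ) p = 𝐞 (-(τ * ((p : ℤ) : ℝ) / d)) * φ p := by
  have hd₀ : (0 : ℝ) < d := by exact_mod_cast hd
  have hphase : τ / √d * (2 * π / √d * ((p : ℤ) : ℝ)) = 2 * π * (τ * ((p : ℤ) : ℝ) / d) := by
    nth_rewrite 3 [← Real.mul_self_sqrt hd₀.le]
    field_simp
  rw [evolution, hamiltonian, ← Matrix.diagonal_smul, Matrix.exp_diagonal, Matrix.mulVec_diagonal,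
    Pi.coe_exp, ← Complex.exp_eq_exp_ℂ, Real.fourierChar_apply, Pi.smul_apply, smul_eq_mul,
    mul_neg, ← hphase]
  congr 2
  push_cast
  ring

/-- The factor which the random walk picks up at the position `p`, after an evolution during the
time `τ / √d`. -/
def stepFactor (d : ℕ) (τ : ℝ) (p : Label d) : ℂ :=
  1 - (1 - 𝐞 τ) * (if (p : ℤ) = ((d : ℤ) - 1) / 2 then 1 else 0)

lemma stepFactor_of_ne {p : Label d} (h : (p : ℤ) ≠ ((d : ℤ) - 1) / 2) (τ : ℝ) :
    stepFactor d τ p = 1 := by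
  rw [stepFactor, if_neg h, mul_zero, sub_zero]

lemma norm_stepFactor (d : ℕ) (τ : ℝ) (p : Label d) : ‖stepFactor d τ p‖ = 1 := by
  rw [stepFactor]
  split_ifs
  · rw [mul_one, sub_sub_cancel, Circle.norm_coe]
  · rw [mul_zero, sub_zero, norm_one]

lemma Label.coe_shift_one (hd : Odd d) (p : Label d) :
    ((Label.shift hd 1 p : Label d) : ℤ) =
      p + 1 - if (p : ℤ) = ((d : ℤ) - 1) / 2 then (d : ℤ) else 0 := by
  have hdvd : (d : ℤ) ∣ (Label.shift hd 1 p : Label d) -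
      (p + 1 - if (p : ℤ) = ((d : ℤ) - 1) / 2 then (d : ℤ) else 0) := by
    rw [← ZMod.intCast_zmod_eq_zero_iff_dvd]
    push_cast [Label.intCast_shift]
    simp
  have hp := p.bounds hd
  have hq := (Label.shift hd 1 p).bounds hd
  refine sub_eq_zero.mp (Int.eq_zero_of_abs_lt_dvd hdvd ?_)
  obtain ⟨k, rfl⟩ := hd
  rw [abs_lt]
  split_ifs <;> push_cast at * <;> omega

lemma shiftForm_zero_evolution (hd : Odd d) (τ : ℝ) (φ : Label d → ℂ) :
    shiftForm hd 0 (fun _ => 1) (evolution d (τ / √d) *ᵥ φ) = shiftForm hd 0 (fun _ => 1) φ := by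
  refine Finset.sum_congr rfl fun p _ => ?_
  simp only [Label.shift_zero, evolution_mulVec hd.pos, map_mul]
  rw [mul_mul_mul_comm, Complex.conj_mul', Circle.norm_coe, Complex.ofReal_one, one_pow, one_mul]

lemma shiftForm_one_evolution (hd : Odd d) (τ : ℝ) (a φ : Label d → ℂ) :
    shiftForm hd 1 a (evolution d (τ / √d) *ᵥ φ) =
      𝐞 (-(τ / d)) * shiftForm hd 1 (fun p => stepFactor d τ p * a p) φ := by
  have hd₀ : (0 : ℝ) < d := by exact_mod_cast hd.pos
  rw [shiftForm, shiftForm, Finset.mul_sum]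
  refine Finset.sum_congr rfl fun p _ => ?_
  have hphase : conj (𝐞 (-(τ * ((p : ℤ) : ℝ) / d)) : ℂ) *
      𝐞 (-(τ * (((Label.shift hd 1 p : Label d) : ℤ) : ℝ) / d)) =
      𝐞 (-(τ / d)) * stepFactor d τ p := by
    rw [← coe_fourierChar_neg, ← coe_fourierChar_add, Label.coe_shift_one, stepFactor]
    split_ifs
    · rw [mul_one, sub_sub_cancel, ← coe_fourierChar_add]
      congr 2
      push_cast
      field_simp
      ring
    · simp only [mul_zero, sub_zero, mul_one]
      congr 2
      push_cast
      ring
  rw [evolution_mulVec hd.pos, evolution_mulVec hd.pos, map_mul]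
  linear_combination (a p * (conj (φ p) * φ (Label.shift hd 1 p))) * hphase

end ShiftForm

/-! ### Expectations of products over a Markov chain -/

section ChainWeight

variable {α : Type*} [Fintype α] {K : α → α → ℝ} {F : ℕ → α → ℂ}

/-- The conditional expectation `p ↦ E (F₀(X₀) ⋯ Fₙ₋₁(Xₙ₋₁) a(Xₙ) | X₀ = p)` for a Markov chain `X`
with transition matrix `K`. The recursion sums out the last position first. -/
def chainWeight (K : α → α → ℝ) (F : ℕ → α → ℂ) : ℕ → (α → ℂ) → α → ℂ
  | 0, a => a
  | n + 1, a => chainWeight K F n fun p => F n p * ∑ q, K p q * a q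

lemma sum_paths_eq_sum_chainWeight (K : α → α → ℝ) (F : ℕ → α → ℂ) (W : α → ℝ) (N : ℕ)
    (a : α → ℂ) :
    ∑ p : Fin (N + 1) → α, ((W (p 0) * ∏ j : Fin N, K (p j.castSucc) (p j.succ) : ℝ) : ℂ) *
        ((∏ j : Fin N, F j (p j.castSucc)) * a (p (Fin.last N))) =
      ∑ p, W p * chainWeight K F N a p := by
  induction N generalizing a with
  | zero =>
    rw [← (Equiv.funUnique (Fin 1) α).sum_comp]
    simp [chainWeight]
  | succ N ih =>
    rw [chainWeight, ← ih, ← (Fin.snocEquiv fun _ : Fin (N + 2) => α).sum_comp,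
      Fintype.sum_prod_type_right]
    refine Finset.sum_congr rfl fun p _ => ?_
    simp only [Finset.mul_sum]
    refine Finset.sum_congr rfl fun q _ => ?_
    simp only [Fin.snocEquiv, Equiv.coe_fn_mk, Fin.prod_univ_castSucc (n := N), Fin.succ_castSucc,
      Fin.snoc_castSucc, Fin.succ_last, Fin.snoc_last, Fin.val_castSucc, Fin.val_last,
      ← Fin.castSucc_zero (n := N + 1)]
    push_cast
    ring

lemma norm_sum_mul_le_one {f : α → ℝ} (hf₀ : 0 ≤ f) (hf₁ : ∑ q, f q = 1) {a : α → ℂ}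
    (ha : ∀ q, ‖a q‖ ≤ 1) : ‖∑ q, f q * a q‖ ≤ 1 := by
  rw [← hf₁]
  refine norm_sum_le_of_le _ fun q _ => ?_
  rw [norm_mul, Complex.norm_real, Real.norm_of_nonneg (hf₀ q)]
  exact mul_le_of_le_one_right (hf₀ q) (ha q)

lemma norm_one_sub_sum_mul_le {f g : α → ℝ} (hf₀ : 0 ≤ f) (hf₁ : ∑ q, f q = 1) {a : α → ℂ}
    (ha : ∀ q, ‖1 - a q‖ ≤ g q) : ‖1 - ∑ q, f q * a q‖ ≤ ∑ q, f q * g q := by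
  have hsub : (1 : ℂ) - ∑ q, f q * a q = ∑ q, f q * (1 - a q) := by
    simp only [mul_sub, mul_one, Finset.sum_sub_distrib]
    rw [← Complex.ofReal_sum, hf₁, Complex.ofReal_one]
  rw [hsub]
  refine norm_sum_le_of_le _ fun q _ => ?_
  rw [norm_mul, Complex.norm_real, Real.norm_of_nonneg (hf₀ q)]
  exact mul_le_mul_of_nonneg_left (ha q) (hf₀ q)

lemma norm_chainWeight_le_one (hK₀ : ∀ p, 0 ≤ K p) (hK₁ : ∀ p, ∑ q, K p q = 1)
    (hF : ∀ j p, ‖F j p‖ ≤ 1) (n : ℕ) {a : α → ℂ} (ha : ∀ p, ‖a p‖ ≤ 1) (p : α) :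
    ‖chainWeight K F n a p‖ ≤ 1 := by
  induction n generalizing a with
  | zero => exact ha p
  | succ n ih =>
    refine ih fun p => ?_
    rw [norm_mul]
    exact mul_le_one₀ (hF n p) (norm_nonneg _) (norm_sum_mul_le_one (hK₀ p) (hK₁ p) ha)

lemma norm_one_sub_sum_mul_le_of_tail {f X : α → ℝ} (hf₀ : 0 ≤ f) (hf₁ : ∑ q, f q = 1) {a : α → ℂ}
    (ha : ∀ q, ‖a q‖ ≤ 1) {Y₁ Y₂ A B : ℝ} (hA : 0 ≤ A) (hB : 0 ≤ B)
    (haA : ∀ q, X q ≤ Y₁ → ‖1 - a q‖ ≤ A) (haB : ∀ q, X q ≤ Y₂ → ‖1 - a q‖ ≤ B) :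
    ‖1 - ∑ q, f q * a q‖ ≤
      A + (∑ q with Y₁ < X q, f q) * B + (∑ q with Y₂ < X q, f q) * 2 := by
  have hbound : ∀ q, ‖1 - a q‖ ≤
      A + (if Y₁ < X q then B else 0) + (if Y₂ < X q then 2 else 0) := fun q => by
    have htwo : ‖1 - a q‖ ≤ 2 := by
      linarith [norm_sub_le 1 (a q), ha q, norm_one (α := ℂ)]
    split_ifs with h₁ h₂ h₂
    · linarith
    · linarith [haB q (not_lt.mp h₂)]
    · linarith
    · linarith [haA q (not_lt.mp h₁)]
  refine (norm_one_sub_sum_mul_le hf₀ hf₁ hbound).trans_eq ?_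
  simp only [mul_add, mul_ite, mul_zero, Finset.sum_add_distrib, ← Finset.sum_filter,
    ← Finset.sum_mul, hf₁, one_mul]

/-- Where a factor differs from `1` the Lyapunov function `G` alone dominates the trivial bound `2`,
so that only the growth rate `lam` of `G` accumulates along the chain. -/
lemma norm_one_sub_chainWeight_le (hK₀ : ∀ p, 0 ≤ K p) (hK₁ : ∀ p, ∑ q, K p q = 1)
    (hF : ∀ j p, ‖F j p‖ ≤ 1) {G : α → ℝ} {lam m : ℝ} (hG : 0 ≤ G) (hm : 0 < m) (hlam : 1 ≤ lam)
    (hKG : ∀ p, ∑ q, K p q * G q ≤ lam * G p) (hFG : ∀ j p, F j p = 1 ∨ m ≤ G p) (n : ℕ)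
    {a : α → ℂ} {c : ℝ} (hc : 2 / m ≤ c) (ha : ∀ p, ‖a p‖ ≤ 1) (haG : ∀ p, ‖1 - a p‖ ≤ c * G p)
    (p : α) : ‖1 - chainWeight K F n a p‖ ≤ c * lam ^ n * G p := by
  induction n generalizing a c with
  | zero => simpa [chainWeight] using haG p
  | succ n ih =>
    have hc₀ : 0 ≤ c := (by positivity : 0 ≤ 2 / m).trans hc
    have hnorm : ∀ p, ‖F n p * ∑ q, K p q * a q‖ ≤ 1 := fun p => by
      rw [norm_mul]
      exact mul_le_one₀ (hF n p) (norm_nonneg _) (norm_sum_mul_le_one (hK₀ p) (hK₁ p) ha)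
    have hdist : ∀ p, ‖1 - F n p * ∑ q, K p q * a q‖ ≤ c * lam * G p := fun p => by
      rcases hFG n p with h | h
      · calc ‖1 - F n p * ∑ q, K p q * a q‖ ≤ ∑ q, K p q * (c * G q) := by
              rw [h, one_mul]
              exact norm_one_sub_sum_mul_le (hK₀ p) (hK₁ p) haG
          _ = c * ∑ q, K p q * G q := by
              rw [Finset.mul_sum]
              exact Finset.sum_congr rfl fun q _ => mul_left_comm _ _ _
          _ ≤ c * lam * G p := by
              rw [mul_assoc]
              exact mul_le_mul_of_nonneg_left (hKG p) hc₀
      · calc ‖1 - F n p * ∑ q, K p q * a q‖ ≤ 1 + 1 := by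
              simpa using (norm_sub_le _ _).trans (add_le_add_right (hnorm p) ‖(1 : ℂ)‖)
          _ = 2 / m * m := by field_simp; norm_num
          _ ≤ c * G p := mul_le_mul hc h hm.le hc₀
          _ ≤ c * lam * G p :=
              mul_le_mul_of_nonneg_right (le_mul_of_one_le_right hc₀ hlam) (hG p)
    calc ‖1 - chainWeight K F (n + 1) a p‖ ≤ c * lam * lam ^ n * G p :=
          ih (hc.trans (le_mul_of_one_le_right hc₀ hlam)) hnorm hdist
      _ = c * lam ^ (n + 1) * G p := by rw [pow_succ', mul_assoc c]

end ChainWeight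

/-! ### Integrating out the outcomes -/

section Moment

variable {d : ℕ} {σsq : ℝ}

lemma setIntegral_Icc_snoc {J : ℕ} {L : ℝ} {F : (Fin J → ℝ) → ℝ → ℂ}
    (hF : Continuous fun x : (Fin J → ℝ) × ℝ => F x.1 x.2) :
    ∫ x in Set.Icc (fun _ : Fin (J + 1) => -L) (fun _ => L), F (Fin.init x) (x (Fin.last J)) =
      ∫ y in Set.Icc (fun _ : Fin J => -L) (fun _ => L), ∫ t in Set.Icc (-L) L, F y t := by
  have hmp := (volume_preserving_piFinSuccAbove (fun _ : Fin (J + 1) => ℝ) (Fin.last J)).symm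
  have hpre : (MeasurableEquiv.piFinSuccAbove (fun _ : Fin (J + 1) => ℝ) (Fin.last J)).symm ⁻¹'
      Set.Icc (fun _ : Fin (J + 1) => -L) (fun _ => L) =
      Set.Icc (-L) L ×ˢ Set.Icc (fun _ : Fin J => -L) (fun _ => L) := by
    ext ⟨t, y⟩
    simp only [Set.mem_preimage, Set.mem_Icc, Set.mem_prod, Pi.le_def, Fin.forall_fin_succ']
    simp [MeasurableEquiv.piFinSuccAbove]
    tauto
  rw [← hmp.setIntegral_preimage_emb (MeasurableEquiv.measurableEmbedding _), hpre,
    Measure.volume_eq_prod, ← setIntegral_prod_swap,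
    ← setIntegral_prod (fun z : (Fin J → ℝ) × ℝ => F z.1 z.2)
      (hF.continuousOn.integrableOn_compact (isCompact_Icc.prod isCompact_Icc))]
  refine integral_congr_ae (ae_of_all _ fun z => ?_)
  have h : Fin.init ((Fin.snocEquiv fun _ : Fin (J + 1) => ℝ) z.swap) = z.1 :=
    Fin.init_snoc (α := fun _ => ℝ) z.2 z.1
  simp [MeasurableEquiv.piFinSuccAbove, h]

lemma continuous_measuredState (hd : 0 < d) (ξsq : ℝ) (hσ : 0 < σsq) (n₀ : ℤ) (δ : ℕ → ℝ)
    (J : ℕ) : Continuous (measuredState d ξsq σsq n₀ δ J) := by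
  induction J with
  | zero => exact continuous_const
  | succ J ih =>
    have hinit : Continuous fun x : Fin (J + 1) → ℝ => Fin.init x :=
      continuous_pi fun i => continuous_apply _
    exact ((continuous_kraus hd hσ).comp (continuous_apply _)).matrix_mulVec
      (continuous_const.matrix_mulVec (ih.comp hinit))

lemma setIntegral_measuredState_succ (hd : Odd d) (ξsq : ℝ) (hσ : 0 < σsq) (n₀ : ℤ) (δ : ℕ → ℝ)
    (J : ℕ) (i j : ℤ) (a : Label d → ℂ) {g : (Fin J → ℝ) → ℂ} (hg : Continuous g) :
    ∫ x in Set.Icc (fun _ : Fin (J + 1) => -(√d / 2)) (fun _ => √d / 2),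
      g (Fin.init x) * (shiftForm hd i a (measuredState d ξsq σsq n₀ δ (J + 1) x) *
        𝐞 (-(j * (x (Fin.last J) / √d)))) =
    ∫ y in Set.Icc (fun _ : Fin J => -(√d / 2)) (fun _ => √d / 2),
      g y * shiftForm hd (i + j)
        (fun n => ∑ p : Label d, (wrap d (krausProd d σsq j) (p - n) : ℂ) * a p)
        (evolution d (δ (J + 1) / √d) *ᵥ measuredState d ξsq σsq n₀ δ J y) := by
  have hstate := continuous_measuredState hd.pos ξsq hσ n₀ δ J
  have h := setIntegral_Icc_snoc (J := J) (L := √d / 2) (F := fun y t =>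
    g y * (shiftForm hd i a (kraus d σsq t *ᵥ
      (evolution d (δ (J + 1) / √d) *ᵥ measuredState d ξsq σsq n₀ δ J y)) *
        𝐞 (-(j * (t / √d))))) (by
    refine (hg.comp continuous_fst).mul (((continuous_shiftForm hd i a).comp ?_).mul
      (continuous_coe_fourierChar.comp (by fun_prop)))
    exact ((continuous_kraus hd.pos hσ).comp continuous_snd).matrix_mulVec
      (continuous_const.matrix_mulVec (hstate.comp continuous_fst)))
  refine h.trans ?_
  simp only [integral_const_mul, setIntegral_shiftForm_kraus hd hσ]

lemma sum_wrap_krausProd_sub (hd : Odd d) (hσ : 0 < σsq) (j : ℤ) (n : Label d) :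
    ∑ p : Label d, (wrap d (krausProd d σsq j) (p - n) : ℂ) =
      ((∑' m : ℤ, krausProd d σsq j m : ℝ) : ℂ) := by
  rw [← Complex.ofReal_sum, sum_label_wrap_sub hd (summable_krausProd hd.pos hσ j)]

lemma clockMoment_eq_setIntegral_shiftForm (hd : Odd d) (ξsq σsq : ℝ) (n₀ : ℤ) (δ : ℕ → ℝ) (J : ℕ)
    (i : Fin J) : clockMoment d ξsq σsq n₀ δ J i =
      ∫ x in Set.Icc (fun _ : Fin J => -(√d / 2)) (fun _ => √d / 2),
        𝐞 (-(x i / √d)) * shiftForm hd 0 (fun _ => 1) (measuredState d ξsq σsq n₀ δ J x) := by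
  refine integral_congr_ae (ae_of_all _ fun x => ?_)
  dsimp only
  rw [outcomeDensity, norm_sq_eq_shiftForm hd, Real.fourierChar_apply]
  congr 2
  push_cast
  ring

lemma clockMoment_castSucc (hd : Odd d) (ξsq : ℝ) (hσ : 0 < σsq) (n₀ : ℤ) (δ : ℕ → ℝ) (J : ℕ)
    (i : Fin J) :
    clockMoment d ξsq σsq n₀ δ (J + 1) i.castSucc = clockMoment d ξsq σsq n₀ δ J i := by
  have h := setIntegral_measuredState_succ hd ξsq hσ n₀ δ J 0 0 (fun _ => 1)
    (g := fun y => 𝐞 (-(y i / √d))) (continuous_coe_fourierChar.comp (by fun_prop))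
  simp only [Int.cast_zero, zero_mul, neg_zero, coe_fourierChar_zero, mul_one,
    sum_wrap_krausProd_sub hd hσ, tsum_krausProd_zero hd.pos hσ, add_zero, Complex.ofReal_one,
    shiftForm_zero_evolution] at h
  rw [clockMoment_eq_setIntegral_shiftForm hd, clockMoment_eq_setIntegral_shiftForm hd]
  exact h

lemma clockMoment_last (hd : Odd d) (ξsq : ℝ) (hσ : 0 < σsq) (n₀ : ℤ) (δ : ℕ → ℝ) (J : ℕ) :
    clockMoment d ξsq σsq n₀ δ (J + 1) (Fin.last J) = imprecisionFactor d σsq *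
      (𝐞 (-(δ (J + 1) / d)) * ∫ y in Set.Icc (fun _ : Fin J => -(√d / 2)) (fun _ => √d / 2),
        shiftForm hd 1 (stepFactor d (δ (J + 1))) (measuredState d ξsq σsq n₀ δ J y)) := by
  have h := setIntegral_measuredState_succ hd ξsq hσ n₀ δ J 0 1 (fun _ => 1)
    (g := fun _ => 1) continuous_const
  simp only [Int.cast_one, one_mul, mul_one, sum_wrap_krausProd_sub hd hσ,
    tsum_krausProd_one hd.pos hσ, zero_add, shiftForm_one_evolution] at h
  simp only [clockMoment_eq_setIntegral_shiftForm hd, mul_comm (𝐞 (-(_ / √(d : ℝ))) : ℂ)]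
  rw [h]
  simp only [mul_comm _ (imprecisionFactor d σsq), shiftForm_const_mul, integral_const_mul]
  ring

lemma setIntegral_shiftForm_one_measuredState (hd : Odd d) (ξsq : ℝ) (hσ : 0 < σsq) (n₀ : ℤ)
    (δ : ℕ → ℝ) (J : ℕ) (a : Label d → ℂ) :
    ∫ y in Set.Icc (fun _ : Fin J => -(√d / 2)) (fun _ => √d / 2),
        shiftForm hd 1 a (measuredState d ξsq σsq n₀ δ J y) =
      𝐞 (-((∑ j ∈ Finset.Icc 1 J, δ j) / d)) *
        shiftForm hd 1 (chainWeight (fun p q => walkJump d σsq ((q : ℤ) - p))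
          (fun j => stepFactor d (δ (j + 1))) J a) (initialState d ξsq n₀) := by
  induction J generalizing a with
  | zero =>
    simp only [measuredState, integral_const]
    rw [measureReal_restrict_apply_univ, Measure.real, Real.volume_Icc_pi]
    simp [chainWeight]
  | succ J ih =>
    have h := setIntegral_measuredState_succ hd ξsq hσ n₀ δ J 1 0 a
      (g := fun _ => 1) continuous_const
    simp only [Int.cast_zero, zero_mul, neg_zero, coe_fourierChar_zero, mul_one, one_mul, add_zero,
      shiftForm_one_evolution, wrap_krausProd_zero hd.pos hσ, integral_const_mul] at h
    rw [h, ih, chainWeight, Finset.sum_Icc_succ_top (by omega), add_div, neg_add_rev,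
      coe_fourierChar_add, mul_assoc]

end Moment

/-! ### The initial state and the exact factorization -/

section Exact

variable {d : ℕ} {ξsq σsq : ℝ}

lemma theta_intCast_div_periodic (hd : 0 < d) (s : ℝ) :
    Function.Periodic (fun m : ℤ => theta (m / d) s) d := fun m => by
  have : (d : ℝ) ≠ 0 := by exact_mod_cast hd.ne'
  rw [← theta_periodic s (m / d)]
  push_cast
  field_simp

lemma sum_label_theta_mul_fourierChar (hd : Odd d) {s : ℝ} (hs : 0 < s) (q : ℤ) :
    ∑ k : Label d, (theta (((k : ℤ) : ℝ) / d) s : ℂ) * 𝐞 (-(((k : ℤ) : ℝ) * q / d)) =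
      d * (wrap d (gauss (π * s)) q : ℂ) := by
  have h := hasSum_sum (s := Finset.univ) fun (k : Label d) _ =>
    (hasSum_theta hs (((k : ℤ) : ℝ) / d)).mul_right (𝐞 (-(((k : ℤ) : ℝ) * q / d)) : ℂ)
  have hwrap := ((Complex.hasSum_ofReal.mpr (hasSum_ite_intCast_eq hd.pos
    (hasSum_gauss (a := π * s) (by positivity)).summable q)).mul_left (d : ℂ))
  refine h.unique (hwrap.congr_fun fun m => ?_)
  have hchar : ∀ k : Label d, (𝐞 (m * (((k : ℤ) : ℝ) / d)) : ℂ) * 𝐞 (-(((k : ℤ) : ℝ) * q / d)) =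
      𝐞 (((k : ℤ) : ℝ) * ((m - q : ℤ) : ℝ) / d) := fun k => by
    rw [← coe_fourierChar_add]
    congr 2
    push_cast
    ring
  simp only [mul_assoc, hchar, ← Finset.mul_sum, sum_label_fourierChar hd,
    Int.cast_sub (R := ZMod d), sub_eq_zero, gauss]
  split_ifs
  · exact mul_comm _ _
  · simp

/-- The factor by which the energy amplitudes of the initial state differ from values of `theta`. -/
def initialScale (d : ℕ) (ξsq : ℝ) : ℝ :=
  √(2 / d) / √(theta 0 (ξsq / (2 * d)) * theta 0 (d * ξsq / 2) +
    theta (1 / 2) (ξsq / (2 * d)) * theta (d / 2) (d * ξsq / 2)) * (1 / √ξsq)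

lemma initialCoeff_mul_timeState (d : ℕ) (hξ : 0 < ξsq) (n₀ : ℤ) (k p : Label d) :
    initialCoeff d ξsq n₀ k * timeState d k p = ((initialScale d ξsq * √ξsq / √d : ℝ) : ℂ) *
      ((theta (((k : ℤ) : ℝ) / d) (ξsq / d) : ℂ) *
        𝐞 (-(((k : ℤ) : ℝ) * (((p : ℤ) - n₀ : ℤ) : ℝ) / d))) := by
  have : √ξsq ≠ 0 := (Real.sqrt_pos.mpr hξ).ne'
  have hphase : (𝐞 (-(((k : ℤ) : ℝ) * (((p : ℤ) - n₀ : ℤ) : ℝ) / d)) : ℂ) =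
      Complex.exp (2 * Real.pi * I * (n₀ : ℂ) * ((k : ℤ) : ℂ) / (d : ℂ)) *
        Complex.exp (-(2 * Real.pi * I * ((k : ℤ) : ℂ) * ((p : ℤ) : ℂ) / (d : ℂ))) := by
    rw [Real.fourierChar_apply, ← Complex.exp_add]
    congr 1
    push_cast
    ring
  rw [hphase, initialCoeff, timeState, initialScale, mul_assoc _ (1 / √ξsq),
    one_div_mul_cancel this]
  push_cast
  ring

lemma initialState_apply (hd : Odd d) (hξ : 0 < ξsq) (n₀ : ℤ) (p : Label d) :
    initialState d ξsq n₀ p =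
      ((initialScale d ξsq * theta ((((p : ℤ) - n₀ : ℤ) : ℝ) / d) (1 / (ξsq * d)) : ℝ) : ℂ) := by
  have : (0 : ℝ) < d := by exact_mod_cast hd.pos
  rw [initialState, Finset.sum_apply]
  simp only [Pi.smul_apply, smul_eq_mul, initialCoeff_mul_timeState d hξ]
  rw [← Finset.mul_sum, sum_label_theta_mul_fourierChar hd (by positivity),
    wrap_gauss (by positivity) hd.pos,
    show π / (π * (ξsq / d) * (d : ℝ) ^ 2) = 1 / (ξsq * d) by field_simp]
  have hscale : √ξsq / √d * (d * √(1 / (ξsq * d))) = 1 := by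
    rw [Real.sqrt_div zero_le_one, Real.sqrt_one, Real.sqrt_mul hξ.le]
    field_simp
    rw [Real.sq_sqrt (by positivity)]
  rw [← Complex.ofReal_natCast, ← Complex.ofReal_mul, ← Complex.ofReal_mul]
  congr 1
  linear_combination (initialScale d ξsq *
    theta ((((p : ℤ) - n₀ : ℤ) : ℝ) / d) (1 / (ξsq * d))) * hscale

/-- The denominator of `waveFactor`, up to a factor the squared norm of the vector of the amplitudes
`theta ((p - n₀) / d) (1 / (ξsq * d))`. -/
def overlapNorm (d : ℕ) (ξsq : ℝ) : ℝ :=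
  theta 0 (1 / (2 * ξsq * d)) * theta 0 (d / (2 * ξsq)) +
    theta (1 / 2) (1 / (2 * ξsq * d)) * theta (1 / 2) (d / (2 * ξsq))

lemma overlapSum_pos (hd : 0 < d) (hξ : 0 < ξsq) : 0 < overlapSum d ξsq := by
  have : (0 : ℝ) < d := by exact_mod_cast hd
  have h₁ := theta_pos (s := 1 / (2 * ξsq * d)) (by positivity)
  have h₂ := theta_pos (s := d / (2 * ξsq)) (by positivity)
  exact add_pos (mul_pos (h₁ _) (h₂ _)) (mul_pos (h₁ _) (h₂ _))

lemma overlapNorm_pos (hd : 0 < d) (hξ : 0 < ξsq) : 0 < overlapNorm d ξsq := by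
  have : (0 : ℝ) < d := by exact_mod_cast hd
  have h₁ := theta_pos (s := 1 / (2 * ξsq * d)) (by positivity)
  have h₂ := theta_pos (s := d / (2 * ξsq)) (by positivity)
  exact add_pos (mul_pos (h₁ _) (h₂ _)) (mul_pos (h₁ _) (h₂ _))

lemma overlapNorm_eq (hd : Odd d) (hξ : 0 < ξsq) :
    overlapNorm d ξsq = ξsq * (theta 0 (ξsq / (2 * d)) * theta 0 (d * ξsq / 2) +
      theta (1 / 2) (ξsq / (2 * d)) * theta (d / 2) (d * ξsq / 2)) := by
  have : (0 : ℝ) < d := by exact_mod_cast hd.pos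
  have hadd := theta_zero_add_theta_half (s := ξsq / (2 * d)) (by positivity)
  have hsub := theta_zero_sub_theta_half (s := ξsq / (2 * d)) (by positivity)
  have hadd' := theta_zero_add_theta_half (s := d * ξsq / 2) (by positivity)
  have hsub' := theta_zero_sub_theta_half (s := d * ξsq / 2) (by positivity)
  rw [show 1 / (4 * (ξsq / (2 * d))) = d / (2 * ξsq) by field_simp; norm_num] at hadd hsub
  rw [show 1 / (4 * (d * ξsq / 2)) = 1 / (2 * ξsq * d) by field_simp; norm_num] at hadd' hsub'
  have hsqrt : √(d / (2 * ξsq)) * √(1 / (2 * ξsq * d)) = 1 / (2 * ξsq) := by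
    rw [← Real.sqrt_mul (by positivity),
      show d / (2 * ξsq) * (1 / (2 * ξsq * d)) = (1 / (2 * ξsq)) ^ 2 by field_simp,
      Real.sqrt_sq (by positivity)]
  have hhalf : theta (d / 2) (d * ξsq / 2) = theta (1 / 2) (d * ξsq / 2) := by
    obtain ⟨k, rfl⟩ := hd
    rw [← theta_add_intCast (1 / 2) _ k]
    congr 1
    push_cast
    ring
  have hcancel : ξsq * (1 / (2 * ξsq)) = 1 / 2 := by field_simp
  rw [overlapNorm, hhalf]
  linear_combination (-ξsq / 2) * ((theta 0 (d * ξsq / 2) + theta (1 / 2) (d * ξsq / 2)) * hadd +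
    (2 * √(d / (2 * ξsq)) * theta 0 (d / (2 * ξsq))) * hadd' +
    (theta 0 (d * ξsq / 2) - theta (1 / 2) (d * ξsq / 2)) * hsub +
    (2 * √(d / (2 * ξsq)) * theta (1 / 2) (d / (2 * ξsq))) * hsub') -
    2 * ξsq * (theta 0 (1 / (2 * ξsq * d)) * theta 0 (d / (2 * ξsq)) +
      theta (1 / 2) (1 / (2 * ξsq * d)) * theta (1 / 2) (d / (2 * ξsq))) * hsqrt -
    2 * (theta 0 (1 / (2 * ξsq * d)) * theta 0 (d / (2 * ξsq)) +
      theta (1 / 2) (1 / (2 * ξsq * d)) * theta (1 / 2) (d / (2 * ξsq))) * hcancel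

lemma initialScale_sq (hd : Odd d) (hξ : 0 < ξsq) :
    initialScale d ξsq ^ 2 = 2 / d / overlapNorm d ξsq := by
  have hN := overlapNorm_pos hd.pos hξ
  rw [overlapNorm_eq hd hξ] at hN ⊢
  rw [initialScale, mul_pow, div_pow, Real.sq_sqrt (by positivity),
    Real.sq_sqrt (pos_of_mul_pos_right hN hξ.le).le, div_pow, Real.sq_sqrt hξ.le]
  field_simp

lemma half_mul_overlapSum (hd : Odd d) (hξ : 0 < ξsq) (n₀ : ℤ) :
    (d : ℝ) / 2 * overlapSum d ξsq =
      ∑ p : Label d, theta ((((p : ℤ) - n₀ + 1 : ℤ) : ℝ) / d) (1 / (ξsq * d)) *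
        theta ((((p : ℤ) - n₀ : ℤ) : ℝ) / d) (1 / (ξsq * d)) := by
  have : (0 : ℝ) < d := by exact_mod_cast hd.pos
  have hperiodic := theta_intCast_div_periodic hd.pos (1 / (ξsq * d))
  have htranslate := sum_label_add hd ((hperiodic.const_add 1).mul hperiodic) (-n₀)
  have hprod := sum_label_theta_mul_theta hd (s := 1 / (ξsq * d)) (by positivity) (1 / d)
  rw [show (d : ℝ) * (1 / d) / 2 = 1 / 2 by field_simp,
    show (d : ℝ) ^ 2 * (1 / (ξsq * d)) / 2 = d / (2 * ξsq) by field_simp,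
    show (1 / (d : ℝ)) / 2 = 1 / (2 * d) by field_simp,
    show 1 / (ξsq * (d : ℝ)) / 2 = 1 / (2 * ξsq * d) by field_simp,
    add_halves, show theta 1 (d / (2 * ξsq)) = theta 0 (d / (2 * ξsq)) by
      simpa using theta_periodic (d / (2 * ξsq)) 0] at hprod
  calc _ = ∑ p : Label d, theta (((p : ℤ) : ℝ) / d) (1 / (ξsq * d)) *
        theta (((p : ℤ) : ℝ) / d + 1 / d) (1 / (ξsq * d)) := by
        rw [hprod, overlapSum]
        ring
    _ = ∑ p : Label d, theta (((1 + p : ℤ) : ℝ) / d) (1 / (ξsq * d)) *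
        theta (((p : ℤ) : ℝ) / d) (1 / (ξsq * d)) :=
      Finset.sum_congr rfl fun p _ => by rw [mul_comm, ← add_div, Int.cast_add, add_comm]; simp
    _ = _ := htranslate.symm.trans <| Finset.sum_congr rfl fun p _ => by
      simp only [Pi.mul_apply, sub_eq_add_neg, add_comm (1 : ℤ)]

lemma shiftForm_initialState (hd : Odd d) (hξ : 0 < ξsq) (n₀ : ℤ) (a : Label d → ℂ) :
    shiftForm hd 1 a (initialState d ξsq n₀) =
      waveFactor d ξsq * ∑ p : Label d, (walkInitial d ξsq n₀ p : ℂ) * a p := by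
  have : (0 : ℝ) < d := by exact_mod_cast hd.pos
  have := overlapSum_pos hd.pos hξ
  have := overlapNorm_pos hd.pos hξ
  rw [shiftForm, Finset.mul_sum]
  refine Finset.sum_congr rfl fun p _ => ?_
  have hshift : theta (((((Label.shift hd 1 p : Label d) : ℤ) - n₀ : ℤ) : ℝ) / d) (1 / (ξsq * d)) =
      theta ((((p : ℤ) - n₀ + 1 : ℤ) : ℝ) / d) (1 / (ξsq * d)) :=
    eq_of_periodic_of_intCast_eq (theta_intCast_div_periodic hd.pos _) (by
      push_cast [Label.intCast_shift]
      ring)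
  have hscale : ∀ x y : ℝ, initialScale d ξsq * x * (initialScale d ξsq * y) =
      waveFactor d ξsq * (y * x / ((d : ℝ) / 2 * overlapSum d ξsq)) := fun x y => by
    rw [waveFactor, ← overlapNorm, mul_mul_mul_comm, ← sq, initialScale_sq hd hξ]
    field_simp
  rw [initialState_apply hd hξ, initialState_apply hd hξ, Complex.conj_ofReal,
    ← Complex.ofReal_mul, hscale, hshift, walkInitial]
  push_cast
  ring

/-- The conditional expectation of the product defining `backactionFactor`, given the first position
of the walk. -/
def backactionWeight (d : ℕ) (σsq : ℝ) (δ : ℕ → ℝ) (N : ℕ) : Label d → ℂ :=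
  chainWeight (fun p q => walkJump d σsq ((q : ℤ) - p)) (fun j => stepFactor d (δ (j + 1))) N
    (stepFactor d (δ (N + 1)))

lemma backactionFactor_eq_sum (d : ℕ) (ξsq σsq : ℝ) (n₀ : ℤ) (δ : ℕ → ℝ) (N : ℕ) :
    backactionFactor d ξsq σsq n₀ δ N =
      ∑ p : Label d, (walkInitial d ξsq n₀ p : ℂ) * backactionWeight d σsq δ N p := by
  simp only [backactionWeight]
  rw [← sum_paths_eq_sum_chainWeight]
  refine Finset.sum_congr rfl fun p _ => ?_
  have hchar : ∀ τ : ℝ, Complex.exp (2 * Real.pi * I * (τ : ℂ)) = 𝐞 τ := fun τ => by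
    rw [Real.fourierChar_apply]
    congr 1
    push_cast
    ring
  simp only [hchar, Fin.prod_univ_castSucc (n := N), Fin.val_castSucc, Fin.val_last, stepFactor]

lemma clockMoment_eq (hd : Odd d) (hξ : 0 < ξsq) (hσ : 0 < σsq) (n₀ : ℤ) (δ : ℕ → ℝ) {J : ℕ}
    (i : Fin J) :
    clockMoment d ξsq σsq n₀ δ J i = 𝐞 (-((∑ j ∈ Finset.Icc 1 (i + 1 : ℕ), δ j) / d)) *
      waveFactor d ξsq * imprecisionFactor d σsq * backactionFactor d ξsq σsq n₀ δ i := by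
  induction J with
  | zero => exact i.elim0
  | succ J ih =>
    cases i using Fin.lastCases with
    | cast i => exact (clockMoment_castSucc hd ξsq hσ n₀ δ J i).trans (ih i)
    | last =>
      rw [clockMoment_last hd ξsq hσ, setIntegral_shiftForm_one_measuredState hd ξsq hσ,
        shiftForm_initialState hd hξ, Fin.val_last, backactionFactor_eq_sum,
        Finset.sum_Icc_succ_top (by omega), add_div, neg_add, coe_fourierChar_add]
      simp only [backactionWeight]
      ring

end Exact

/-! ### The walk rarely reaches the edge of the spectrum -/

lemma cosh_le_exp_abs (x : ℝ) : Real.cosh x ≤ Real.exp |x| := by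
  rw [← Real.cosh_abs, Real.cosh_eq]
  linarith [Real.exp_le_exp.mpr (neg_le_self (abs_nonneg x))]

lemma two_div_cosh_le (x : ℝ) : 2 / Real.cosh x ≤ 4 * Real.exp (-x) := by
  rw [div_le_iff₀ (Real.cosh_pos _), Real.cosh_eq, mul_assoc, mul_div_assoc', mul_add,
    ← Real.exp_add, neg_add_cancel, Real.exp_zero]
  linarith [mul_pos (Real.exp_pos (-x)) (Real.exp_pos (-x))]

section Walk

variable {d : ℕ} {ξsq σsq : ℝ}

lemma walkJump_nonneg (hd : 0 < d) (hσ : 0 < σsq) (q : ℤ) : 0 ≤ walkJump d σsq q := by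
  have : (0 : ℝ) < d := by exact_mod_cast hd
  rw [walkJump_eq_wrap_gauss hd hσ]
  exact div_nonneg (wrap_gauss_pos (by positivity) hd q).le (theta_pos (by positivity) 0).le

lemma sum_walkJump (hd : Odd d) (hσ : 0 < σsq) (p : ℤ) :
    ∑ q : Label d, walkJump d σsq (q - p) = 1 := by
  simp only [← wrap_krausProd_zero hd.pos hσ]
  rw [sum_label_wrap_sub hd (summable_krausProd hd.pos hσ 0), tsum_krausProd_zero hd.pos hσ]

lemma sum_walkJump_mul_cosh_le (hd : Odd d) (hσ : 0 < σsq) (r : ℝ) (p : ℤ) :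
    ∑ q : Label d, walkJump d σsq (q - p) * Real.cosh (r * ((q : ℤ) + 1 / 2)) ≤
      Real.exp (r ^ 2 * d / (8 * π * σsq)) * Real.cosh (r * (p + 1 / 2)) := by
  have : (0 : ℝ) < d := by exact_mod_cast hd.pos
  have h := sum_wrap_gauss_sub_mul_cosh_le (a := 2 * π * σsq / d) (by positivity) hd p
    (x := 1 / 2) (by norm_num) r
  rw [show 2 * π * σsq / d / π = 2 * σsq / d by field_simp,
    show r ^ 2 / (4 * (2 * π * σsq / d)) = r ^ 2 * d / (8 * π * σsq) by field_simp; ring] at h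
  simp only [walkJump_eq_wrap_gauss hd.pos hσ, div_mul_eq_mul_div, ← Finset.sum_div]
  rwa [div_le_iff₀ (theta_pos (by positivity) 0)]

lemma norm_backactionWeight_le_one (hd : Odd d) (hσ : 0 < σsq) (δ : ℕ → ℝ) (N : ℕ)
    (p : Label d) :
    ‖backactionWeight d σsq δ N p‖ ≤ 1 :=
  norm_chainWeight_le_one (fun _ _ => walkJump_nonneg hd.pos hσ _)
    (fun p : Label d => sum_walkJump hd hσ p) (fun _ _ => (norm_stepFactor _ _ _).le) N
    (fun _ => (norm_stepFactor _ _ _).le) p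

lemma stepFactor_eq_one_or (hd : Odd d) (τ r : ℝ) (p : Label d) :
    stepFactor d τ p = 1 ∨ Real.cosh (r * (d / 2)) ≤ Real.cosh (r * ((p : ℤ) + 1 / 2)) := by
  refine or_iff_not_imp_left.mpr fun hp => le_of_eq ?_
  have hedge : (p : ℤ) = ((d : ℤ) - 1) / 2 := not_imp_comm.mp (fun h => stepFactor_of_ne h τ) hp
  have hdouble : 2 * (p : ℤ) + 1 = d := by obtain ⟨k, rfl⟩ := hd; push_cast at hedge ⊢; omega
  have : 2 * ((p : ℤ) : ℝ) + 1 = d := by exact_mod_cast hdouble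
  rw [← this]
  ring_nf

lemma norm_one_sub_backactionWeight_le_cosh (hd : Odd d) (hσ : 0 < σsq) (δ : ℕ → ℝ) (r : ℝ)
    (N : ℕ) (p : Label d) :
    ‖1 - backactionWeight d σsq δ N p‖ ≤ 2 / Real.cosh (r * (d / 2)) *
      Real.exp (r ^ 2 * d / (8 * π * σsq)) ^ N * Real.cosh (r * ((p : ℤ) + 1 / 2)) := by
  have : (0 : ℝ) < d := by exact_mod_cast hd.pos
  have hcosh := Real.cosh_pos (r * (d / 2))
  have hlast : ∀ q : Label d, ‖1 - stepFactor d (δ (N + 1)) q‖ ≤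
      2 / Real.cosh (r * (d / 2)) * Real.cosh (r * ((q : ℤ) + 1 / 2)) := fun q => by
    rcases stepFactor_eq_one_or hd (δ (N + 1)) r q with h | h
    · rw [h, sub_self, norm_zero]
      exact mul_nonneg (div_nonneg zero_le_two hcosh.le) (Real.cosh_pos _).le
    · calc ‖1 - stepFactor d (δ (N + 1)) q‖ ≤ 1 + 1 := by
            simpa [norm_stepFactor] using norm_sub_le 1 (stepFactor d (δ (N + 1)) q)
        _ = 2 / Real.cosh (r * (d / 2)) * Real.cosh (r * (d / 2)) := by
            rw [div_mul_cancel₀ _ hcosh.ne']; norm_num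
        _ ≤ _ := by gcongr
  exact norm_one_sub_chainWeight_le (G := fun p : Label d => Real.cosh (r * ((p : ℤ) + 1 / 2)))
    (K := fun p q : Label d => walkJump d σsq ((q : ℤ) - p))
    (F := fun j => stepFactor d (δ (j + 1)))
    (fun _ _ => walkJump_nonneg hd.pos hσ _) (fun p : Label d => sum_walkJump hd hσ p)
    (fun _ _ => (norm_stepFactor _ _ _).le) (fun _ => (Real.cosh_pos _).le) hcosh
    (Real.one_le_exp (by positivity)) (fun p : Label d => sum_walkJump_mul_cosh_le hd hσ r p)
    (fun _ => stepFactor_eq_one_or hd _ r) N le_rfl (fun _ => (norm_stepFactor _ _ _).le) hlast p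

/-- A bound on the effect, during `M` jumps, of the edge of the spectrum on a walk that starts
within distance `Y` of `0`. -/
def walkEdgeBound (d : ℕ) (σsq M Y : ℝ) : ℝ :=
  4 * Real.exp (π * σsq / M) * Real.exp (-(2 * π * σsq * (d / 2 - Y) ^ 2 / (d * M)))

lemma norm_one_sub_backactionWeight_le (hd : Odd d) (hσ : 0 < σsq) (δ : ℕ → ℝ) {N : ℕ} {M Y : ℝ}
    (hM : 0 < M) (hN : N ≤ M) (hY : Y ≤ d / 2) {p : Label d} (hp : |((p : ℤ) : ℝ)| ≤ Y) :
    ‖1 - backactionWeight d σsq δ N p‖ ≤ walkEdgeBound d σsq M Y := by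
  have : (0 : ℝ) < d := by exact_mod_cast hd.pos
  have hY₀ : 0 ≤ Y := (abs_nonneg _).trans hp
  -- the rate minimizing the exponent `M r² d / (8 π σ²) - r (d / 2 - Y)`
  set r := 4 * π * σsq * (d / 2 - Y) / (d * M) with hr
  have hr₀ : 0 ≤ r := div_nonneg (mul_nonneg (by positivity) (sub_nonneg.mpr hY)) (by positivity)
  have hpow : Real.exp (r ^ 2 * d / (8 * π * σsq)) ^ N ≤
      Real.exp (M * (r ^ 2 * d / (8 * π * σsq))) := by
    rw [← Real.exp_nat_mul]
    gcongr
  have hstart : Real.cosh (r * ((p : ℤ) + 1 / 2)) ≤ Real.exp (r * (Y + 1 / 2)) := by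
    refine (cosh_le_exp_abs _).trans (Real.exp_le_exp.mpr ?_)
    rw [abs_mul, abs_of_nonneg hr₀]
    refine mul_le_mul_of_nonneg_left ((abs_add_le _ _).trans ?_) hr₀
    rw [abs_of_pos (one_half_pos (α := ℝ))]
    exact add_le_add_left hp _
  have hexponent : -(r * (d / 2)) + M * (r ^ 2 * d / (8 * π * σsq)) + r * (Y + 1 / 2) =
      2 * π * σsq * (d / 2 - Y) / (d * M) + -(2 * π * σsq * (d / 2 - Y) ^ 2 / (d * M)) := by
    rw [hr]
    field_simp
    ring
  have hfactor : 2 * π * σsq * (d / 2 - Y) / (d * M) ≤ π * σsq / M := by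
    rw [div_le_div_iff₀ (by positivity) hM]
    have : 0 ≤ π * σsq * M * Y := by positivity
    linarith
  calc ‖1 - backactionWeight d σsq δ N p‖ ≤ 4 * Real.exp (-(r * (d / 2))) *
        Real.exp (M * (r ^ 2 * d / (8 * π * σsq))) * Real.exp (r * (Y + 1 / 2)) := by
        refine (norm_one_sub_backactionWeight_le_cosh hd hσ δ r N p).trans ?_
        have := Real.cosh_pos (r * ((p : ℤ) + 1 / 2))
        have := two_div_cosh_le (r * (d / 2))
        gcongr
    _ = 4 * Real.exp (2 * π * σsq * (d / 2 - Y) / (d * M)) *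
        Real.exp (-(2 * π * σsq * (d / 2 - Y) ^ 2 / (d * M))) := by
        rw [mul_assoc 4, ← Real.exp_add, mul_assoc 4, ← Real.exp_add, mul_assoc 4, ← Real.exp_add,
          hexponent]
    _ ≤ walkEdgeBound d σsq M Y := by
        rw [walkEdgeBound]
        gcongr

lemma walkInitial_nonneg (hd : 0 < d) (hξ : 0 < ξsq) (n₀ : ℤ) (p : Label d) :
    0 ≤ walkInitial d ξsq n₀ p := by
  have : (0 : ℝ) < d := by exact_mod_cast hd
  have hpos := theta_pos (s := 1 / (ξsq * d)) (by positivity)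
  have := overlapSum_pos hd hξ
  exact div_nonneg (mul_pos (hpos _) (hpos _)).le (by positivity)

lemma sum_walkInitial (hd : Odd d) (hξ : 0 < ξsq) (n₀ : ℤ) :
    ∑ p : Label d, walkInitial d ξsq n₀ p = 1 := by
  have : (0 : ℝ) < d := by exact_mod_cast hd.pos
  have := overlapSum_pos hd.pos hξ
  simp only [walkInitial, ← Finset.sum_div]
  rw [← half_mul_overlapSum hd hξ]
  exact div_self (by positivity)

lemma theta_mul_theta_zero_le_half_mul_overlapSum (hd : Odd d) (hξ : 0 < ξsq) :
    theta (1 / d) (1 / (ξsq * d)) * theta 0 (1 / (ξsq * d)) ≤ (d : ℝ) / 2 * overlapSum d ξsq := by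
  have : (0 : ℝ) < d := by exact_mod_cast hd.pos
  have hpos := theta_pos (s := 1 / (ξsq * d)) (by positivity)
  have hmem : (0 : ℤ) ∈ Finset.Icc (-(((d : ℤ) - 1) / 2)) (((d : ℤ) - 1) / 2) := by
    have := hd.pos
    rw [Finset.mem_Icc]
    omega
  rw [half_mul_overlapSum hd hξ 0]
  refine le_of_eq_of_le ?_ (Finset.single_le_sum (fun p _ => (mul_pos (hpos _) (hpos _)).le)
    (Finset.mem_univ (⟨0, hmem⟩ : Label d)))
  simp

lemma walkInitial_le (hd : Odd d) (hξ : 0 < ξsq) (n₀ : ℤ) (p : Label d) :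
    walkInitial d ξsq n₀ p ≤
      Real.exp (π * ξsq / d) * wrap d (gauss (π * ξsq / d)) ((p : ℤ) - n₀) := by
  have : (0 : ℝ) < d := by exact_mod_cast hd.pos
  have hpos := theta_pos (s := 1 / (ξsq * d)) (by positivity)
  have := overlapSum_pos hd.pos hξ
  have hone : 1 ≤ Real.exp (π * ξsq / d) *
      (√(1 / (ξsq * d)) * theta (1 / d) (1 / (ξsq * d))) := by
    have h := exp_neg_sq_le_sqrt_mul_theta (s := 1 / (ξsq * d)) (by positivity) (1 / d)
    rw [show π / (1 / (ξsq * d)) * (1 / (d : ℝ)) ^ 2 = π * ξsq / d by field_simp] at h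
    rwa [← div_le_iff₀' (Real.exp_pos _), one_div, ← Real.exp_neg]
  rw [wrap_gauss (by positivity) hd.pos,
    show π / (π * ξsq / d * (d : ℝ) ^ 2) = 1 / (ξsq * d) by field_simp, walkInitial,
    div_le_iff₀ (by positivity)]
  set s := 1 / (ξsq * d)
  set w := theta (((p : ℤ) - n₀ : ℤ) / d) s
  have hw₀ : 0 < w := hpos _
  have := hpos 0
  calc _ ≤ theta 0 s * w := by gcongr; exact theta_le_theta_zero (by positivity) _
    _ ≤ (Real.exp (π * ξsq / d) * (√s * theta (1 / d) s)) * (theta 0 s * w) :=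
        le_mul_of_one_le_left (by positivity) hone
    _ = Real.exp (π * ξsq / d) * (√s * w) * (theta (1 / d) s * theta 0 s) := by ring
    _ ≤ _ := mul_le_mul_of_nonneg_left (theta_mul_theta_zero_le_half_mul_overlapSum hd hξ)
        (by positivity)

/-- A bound on the probability that the walk starts at distance more than `Y` from `0`. -/
def walkTailBound (d : ℕ) (ξsq : ℝ) (n₀ : ℤ) (Y : ℝ) : ℝ :=
  2 * Real.exp (π * ξsq / d) * theta 0 (ξsq / d) *
    Real.exp (-(π * ξsq / d * (Y - |(n₀ : ℝ)|) ^ 2))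

lemma one_le_two_mul_exp_mul_cosh {r x Y : ℝ} (hr : 0 ≤ r) (hx : Y ≤ |x|) :
    1 ≤ 2 * Real.exp (-(r * Y)) * Real.cosh (r * x) := by
  have hexp : Real.exp (r * Y) ≤ Real.exp (r * |x|) := by gcongr
  rw [← Real.cosh_abs, abs_mul, abs_of_nonneg hr, Real.exp_neg, mul_right_comm, ← div_eq_mul_inv,
    Real.cosh_eq, mul_div_cancel₀ _ two_ne_zero, one_le_div (Real.exp_pos _)]
  linarith [Real.exp_pos (-(r * |x|))]

lemma sum_walkInitial_le_exp_mul (hd : Odd d) (hξ : 0 < ξsq) (n₀ : ℤ) {r : ℝ} (hr : 0 ≤ r)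
    (Y : ℝ) :
    ∑ p ∈ Finset.univ.filter (fun p : Label d => Y < |((p : ℤ) : ℝ)|), walkInitial d ξsq n₀ p ≤
      2 * Real.exp (π * ξsq / d) * Real.exp (-(r * Y)) *
        (Real.exp (r ^ 2 / (4 * (π * ξsq / d))) * Real.exp (r * |(n₀ : ℝ)|) *
          theta 0 (ξsq / d)) := by
  have : (0 : ℝ) < d := by exact_mod_cast hd.pos
  set b := π * ξsq / d with hb
  have hb₀ : 0 < b := by positivity
  have hmoment := sum_wrap_gauss_sub_mul_cosh_le hb₀ hd n₀ (x := 0) (by norm_num) r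
  rw [show b / π = ξsq / d by rw [hb]; field_simp] at hmoment
  simp only [add_zero] at hmoment
  have hcosh : Real.cosh (r * n₀) ≤ Real.exp (r * |(n₀ : ℝ)|) := by
    simpa only [abs_mul, abs_of_nonneg hr] using cosh_le_exp_abs (r * n₀)
  have := theta_pos (s := ξsq / d) (by positivity) 0
  have hw := fun q => (wrap_gauss_pos hb₀ hd.pos q).le
  have hterm : ∀ p : Label d, Y < |((p : ℤ) : ℝ)| → walkInitial d ξsq n₀ p ≤
      2 * Real.exp b * Real.exp (-(r * Y)) *
        (wrap d (gauss b) ((p : ℤ) - n₀) * Real.cosh (r * (p : ℤ))) := fun p hp =>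
    calc walkInitial d ξsq n₀ p ≤ Real.exp b * wrap d (gauss b) ((p : ℤ) - n₀) :=
          walkInitial_le hd hξ n₀ p
      _ ≤ Real.exp b * wrap d (gauss b) ((p : ℤ) - n₀) *
          (2 * Real.exp (-(r * Y)) * Real.cosh (r * (p : ℤ))) :=
          le_mul_of_one_le_right (mul_nonneg (Real.exp_pos _).le (hw _))
            (one_le_two_mul_exp_mul_cosh hr hp.le)
      _ = _ := by ring
  refine (Finset.sum_le_sum fun p hp => hterm p (Finset.mem_filter.mp hp).2).trans ?_
  refine (Finset.sum_le_univ_sum_of_nonneg fun p : Label d =>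
    mul_nonneg (by positivity) (mul_nonneg (hw _) (Real.cosh_pos _).le)).trans ?_
  rw [← Finset.mul_sum]
  refine mul_le_mul_of_nonneg_left (hmoment.trans ?_) (by positivity)
  gcongr

lemma sum_walkInitial_le_walkTailBound (hd : Odd d) (hξ : 0 < ξsq) {n₀ : ℤ} {Y : ℝ}
    (hY : |(n₀ : ℝ)| ≤ Y) :
    ∑ p ∈ Finset.univ.filter (fun p : Label d => Y < |((p : ℤ) : ℝ)|), walkInitial d ξsq n₀ p ≤
      walkTailBound d ξsq n₀ Y := by
  have : (0 : ℝ) < d := by exact_mod_cast hd.pos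
  have hr : 0 ≤ 2 * (π * ξsq / d) * (Y - |(n₀ : ℝ)|) :=
    mul_nonneg (by positivity) (sub_nonneg.mpr hY)
  refine (sum_walkInitial_le_exp_mul hd hξ n₀ hr Y).trans_eq ?_
  set b := π * ξsq / d
  have hb : b ≠ 0 := by positivity
  have hexponent : -(2 * b * (Y - |(n₀ : ℝ)|) * Y) + (2 * b * (Y - |(n₀ : ℝ)|)) ^ 2 / (4 * b) +
      2 * b * (Y - |(n₀ : ℝ)|) * |(n₀ : ℝ)| = -(b * (Y - |(n₀ : ℝ)|) ^ 2) := by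
    field_simp
    ring
  rw [walkTailBound, ← hexponent, Real.exp_add, Real.exp_add]
  ring

lemma norm_one_sub_backactionFactor_le (hd : Odd d) (hξ : 0 < ξsq) (hσ : 0 < σsq) {n₀ : ℤ}
    (δ : ℕ → ℝ) {N : ℕ} {M Y₁ Y₂ : ℝ} (hM : 0 < M) (hN : N ≤ M) (hY₁ : |(n₀ : ℝ)| ≤ Y₁)
    (hY : Y₁ ≤ Y₂) (hY₂ : Y₂ ≤ d / 2) :
    ‖1 - backactionFactor d ξsq σsq n₀ δ N‖ ≤ walkEdgeBound d σsq M Y₁ +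
      walkTailBound d ξsq n₀ Y₁ * walkEdgeBound d σsq M Y₂ + walkTailBound d ξsq n₀ Y₂ * 2 := by
  have hnonneg : ∀ Y, 0 ≤ walkEdgeBound d σsq M Y := fun Y => by
    rw [walkEdgeBound]; positivity
  rw [backactionFactor_eq_sum]
  refine (norm_one_sub_sum_mul_le_of_tail (walkInitial_nonneg hd.pos hξ n₀)
    (sum_walkInitial hd hξ n₀) (norm_backactionWeight_le_one hd hσ δ N) (hnonneg Y₁) (hnonneg Y₂)
    (fun p => norm_one_sub_backactionWeight_le hd hσ δ hM hN (hY.trans hY₂))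
    (fun p => norm_one_sub_backactionWeight_le hd hσ δ hM hN hY₂)).trans ?_
  gcongr
  · exact hnonneg Y₂
  · exact sum_walkInitial_le_walkTailBound hd hξ hY₁
  · exact sum_walkInitial_le_walkTailBound hd hξ (hY₁.trans hY)

end Walk

/-! ### Asymptotics of the backaction factor -/

lemma exists_sq_mul_exp_neg_rpow_le {κ η : ℝ} (hκ : 0 < κ) (hη : 0 < η) :
    ∃ K ≥ 0, ∀ x : ℝ, 1 ≤ x → x ^ 2 * Real.exp (-κ * x ^ η) ≤ K := by
  obtain ⟨n, hn⟩ := exists_nat_gt (2 / η)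
  refine ⟨n.factorial / κ ^ n, by positivity, fun x hx => ?_⟩
  have hexp := Real.pow_div_factorial_le_exp (κ * x ^ η) (by positivity) n
  have hpow : x ^ 2 ≤ (x ^ η) ^ n := by
    rw [← Real.rpow_natCast, ← Real.rpow_natCast, ← Real.rpow_mul (by positivity)]
    rw [div_lt_iff₀' hη] at hn
    exact Real.rpow_le_rpow_of_exponent_le hx (by exact_mod_cast hn.le)
  rw [neg_mul, Real.exp_neg, ← div_eq_mul_inv, div_le_div_iff₀ (Real.exp_pos _) (by positivity)]
  rw [div_le_iff₀' (by positivity), mul_pow] at hexp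
  refine (mul_le_mul_of_nonneg_right hpow (by positivity)).trans ?_
  rwa [mul_comm]

lemma exists_mul_exp_neg_rpow_le {κ η : ℝ} (hκ : 0 < κ) (hη : 0 < η) :
    ∃ K ≥ 0, ∀ x : ℝ, 1 ≤ x → x * Real.exp (-κ * x ^ η) ≤ K * x⁻¹ := by
  obtain ⟨K, hK, h⟩ := exists_sq_mul_exp_neg_rpow_le hκ hη
  refine ⟨K, hK, fun x hx => ?_⟩
  rw [← div_eq_mul_inv, le_div_iff₀ (by positivity), mul_right_comm, ← sq]
  exact h x hx

lemma walkEdgeBound_le {c t β : ℝ} (hc : 0 < c) (ht : 0 < t) (hβ : β ≤ 0) {d : ℕ} (hd : 0 < d)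
    (γ : ℝ) :
    walkEdgeBound d (c * (d : ℝ) ^ β) (t * √d) (γ * (d / 2)) ≤
      4 * Real.exp (π * c / t) *
        Real.exp (-(π * c * (1 - γ) ^ 2 / (2 * t)) * (d : ℝ) ^ (1 / 2 + β)) := by
  have hx : (1 : ℝ) ≤ d := by exact_mod_cast hd
  have hx₀ : (0 : ℝ) < d := by linarith
  have hsqrt := Real.one_le_sqrt.mpr hx
  have hrpow : (d : ℝ) ^ β ≤ 1 := Real.rpow_le_one_of_one_le_of_nonpos hx hβ
  have hprefactor : π * (c * (d : ℝ) ^ β) / (t * √d) ≤ π * c / t := by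
    rw [← mul_assoc]
    exact div_le_div₀ (by positivity) (mul_le_of_le_one_right (by positivity) hrpow) ht
      (le_mul_of_one_le_right ht.le hsqrt)
  have hexponent : 2 * π * (c * (d : ℝ) ^ β) * (d / 2 - γ * (d / 2)) ^ 2 / (d * (t * √d)) =
      π * c * (1 - γ) ^ 2 / (2 * t) * (d : ℝ) ^ (1 / 2 + β) := by
    rw [Real.rpow_add hx₀, ← Real.sqrt_eq_rpow]
    have hd₂ : (d : ℝ) = √d ^ 2 := (Real.sq_sqrt hx₀.le).symm
    field_simp
    rw [← hd₂]
    ring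
  rw [walkEdgeBound, hexponent, neg_mul]
  gcongr

lemma theta_zero_mul_rpow_div_le {c α x : ℝ} (hc : 0 < c) (hα : -1 ≤ α) (hα' : α ≤ 1)
    (hx : 1 ≤ x) : theta 0 (c * x ^ α / x) ≤ theta 0 (1 / c) / √c * x := by
  have hx₀ : 0 < x := by linarith
  set s := c * x ^ α / x with hs
  have hs₀ : 0 < s := by positivity
  have hle : s ≤ c := by
    rw [hs, div_le_iff₀ hx₀]
    gcongr
    simpa using Real.rpow_le_rpow_of_exponent_le hx hα'
  have hge : √c / x ≤ √s := by
    have : 1 ≤ x ^ α * x := by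
      have := Real.one_le_rpow hx (show 0 ≤ α + 1 by linarith)
      rwa [Real.rpow_add hx₀, Real.rpow_one] at this
    refine Real.le_sqrt_of_sq_le ?_
    rw [div_pow, Real.sq_sqrt hc.le, hs, sq, ← div_div]
    gcongr
    rw [div_le_iff₀ hx₀, mul_assoc]
    exact le_mul_of_one_le_right hc.le this
  have hdual : √s * theta 0 s ≤ theta 0 (1 / c) := by
    rw [sqrt_mul_theta_zero hs₀]
    exact theta_zero_antitoneOn (Set.mem_Ioi.mpr (by positivity)) (Set.mem_Ioi.mpr (by positivity))
      (one_div_le_one_div_of_le hs₀ hle)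
  rw [div_mul_eq_mul_div, le_div_iff₀ (Real.sqrt_pos.mpr hc)]
  calc theta 0 s * √c = √c / x * theta 0 s * x := by field_simp
    _ ≤ √s * theta 0 s * x := by have := theta_pos hs₀ 0; gcongr
    _ ≤ theta 0 (1 / c) * x := by gcongr

lemma walkTailBound_le {c α : ℝ} (hc : 0 < c) (hα : -1 ≤ α) (hα' : α ≤ 1) {d : ℕ} (hd : 0 < d)
    (n₀ : ℤ) (γ : ℝ) :
    walkTailBound d (c * (d : ℝ) ^ α) n₀ (γ * (d / 2)) ≤
      2 * Real.exp (π * c) * (theta 0 (1 / c) / √c) *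
        (d * Real.exp (-(π * c * (γ - 2 * |(n₀ : ℝ)| / d) ^ 2 / 4) * (d : ℝ) ^ (1 + α))) := by
  have hx : (1 : ℝ) ≤ d := by exact_mod_cast hd
  have hx₀ : (0 : ℝ) < d := by linarith
  have hprefactor : π * (c * (d : ℝ) ^ α) / d ≤ π * c := by
    rw [div_le_iff₀ hx₀, ← mul_assoc]
    gcongr
    simpa using Real.rpow_le_rpow_of_exponent_le hx hα'
  have hexponent : π * (c * (d : ℝ) ^ α) / d * (γ * (d / 2) - |(n₀ : ℝ)|) ^ 2 =
      π * c * (γ - 2 * |(n₀ : ℝ)| / d) ^ 2 / 4 * (d : ℝ) ^ (1 + α) := by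
    rw [Real.rpow_add hx₀, Real.rpow_one]
    field_simp
    ring
  have := theta_pos (s := c * (d : ℝ) ^ α / d) (by positivity) 0
  have := theta_zero_mul_rpow_div_le hc hα hα' hx
  rw [walkTailBound, hexponent, ← neg_mul, ← mul_assoc _ (d : ℝ), mul_assoc _ _ (d : ℝ)]
  gcongr

lemma walkTailBound_half_one_add_le {c α : ℝ} (hc : 0 < c) (hα : -1 ≤ α) (hα' : α ≤ 1) {d : ℕ}
    (hd : 0 < d) {n₀ : ℤ} {γ : ℝ} (hγ : γ ≤ 1) (hn₀ : |(n₀ : ℝ)| ≤ γ * (d / 2)) :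
    walkTailBound d (c * (d : ℝ) ^ α) n₀ ((1 + γ) / 2 * (d / 2)) ≤
      2 * Real.exp (π * c) * (theta 0 (1 / c) / √c) *
        (d * Real.exp (-(π * c * (1 - γ) ^ 2 / 16) * (d : ℝ) ^ (1 + α))) *
        Real.exp (-(π * c * (γ - 2 * |(n₀ : ℝ)| / d) ^ 2 / 4) * (d : ℝ) ^ (1 + α)) := by
  have hx₀ : (0 : ℝ) < d := by exact_mod_cast hd
  have := theta_pos (s := 1 / c) (by positivity) 0
  set y := 2 * |(n₀ : ℝ)| / d
  have hy : 0 ≤ γ - y := by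
    rw [sub_nonneg, div_le_iff₀ hx₀]
    linarith
  have hsq : (γ - y) ^ 2 + (1 - γ) ^ 2 / 4 ≤ ((1 + γ) / 2 - y) ^ 2 := by
    nlinarith [mul_nonneg hy (sub_nonneg.mpr hγ)]
  have hexp : Real.exp (-(π * c * ((1 + γ) / 2 - y) ^ 2 / 4) * (d : ℝ) ^ (1 + α)) ≤
      Real.exp (-(π * c * (1 - γ) ^ 2 / 16) * (d : ℝ) ^ (1 + α)) *
        Real.exp (-(π * c * (γ - y) ^ 2 / 4) * (d : ℝ) ^ (1 + α)) := by
    rw [← Real.exp_add, ← add_mul]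
    gcongr
    have := mul_le_mul_of_nonneg_left hsq (show 0 ≤ π * c / 4 by positivity)
    linarith
  calc _ ≤ _ := walkTailBound_le hc hα hα' hd n₀ ((1 + γ) / 2)
    _ ≤ 2 * Real.exp (π * c) * (theta 0 (1 / c) / √c) *
        (d * (Real.exp (-(π * c * (1 - γ) ^ 2 / 16) * (d : ℝ) ^ (1 + α)) *
          Real.exp (-(π * c * (γ - y) ^ 2 / 4) * (d : ℝ) ^ (1 + α)))) := by gcongr
    _ = _ := by ring

lemma norm_one_sub_backactionFactor_rpow_le {c₁ c₂ α β γ t : ℝ} (hc₁ : 0 < c₁) (hc₂ : 0 < c₂)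
    (hα : -1 ≤ α) (hα' : α ≤ 1) (hβ : β ≤ 0) (hγ : γ ≤ 1) (ht : 0 < t) {d : ℕ} (hd : Odd d)
    {n₀ : ℤ} (hn₀ : |(n₀ : ℝ)| ≤ γ * (d / 2)) (δ : ℕ → ℝ) {N : ℕ} (hN : N ≤ t * √d) :
    ‖1 - backactionFactor d (c₁ * (d : ℝ) ^ α) (c₂ * (d : ℝ) ^ β) n₀ δ N‖ ≤
      4 * Real.exp (π * c₂ / t) *
          Real.exp (-(π * c₂ * (1 - γ) ^ 2 / (2 * t)) * (d : ℝ) ^ (1 / 2 + β)) +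
        2 * Real.exp (π * c₁) * (theta 0 (1 / c₁) / √c₁) *
          (4 * Real.exp (π * c₂ / t) *
              (d * Real.exp (-(π * c₂ * (1 - (1 + γ) / 2) ^ 2 / (2 * t)) * (d : ℝ) ^ (1 / 2 + β))) +
            2 * (d * Real.exp (-(π * c₁ * (1 - γ) ^ 2 / 16) * (d : ℝ) ^ (1 + α)))) *
          Real.exp (-(π * c₁ * (γ - 2 * |(n₀ : ℝ)| / d) ^ 2 / 4) * (d : ℝ) ^ (1 + α)) := by
  have : (0 : ℝ) < d := by exact_mod_cast hd.pos
  have := theta_pos (s := 1 / c₁) (by positivity) 0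
  have hY : γ * ((d : ℝ) / 2) ≤ (1 + γ) / 2 * (d / 2) := by gcongr; linarith
  have hY₂ : (1 + γ) / 2 * ((d : ℝ) / 2) ≤ d / 2 :=
    mul_le_of_le_one_left (by positivity) (by linarith)
  have hedge_nonneg (Y : ℝ) : 0 ≤ walkEdgeBound d (c₂ * (d : ℝ) ^ β) (t * √d) Y := by
    rw [walkEdgeBound]; positivity
  refine (norm_one_sub_backactionFactor_le hd (by positivity) (by positivity) δ (by positivity) hN
    hn₀ hY hY₂).trans ?_
  rw [mul_add, add_mul, ← add_assoc]
  refine add_le_add (add_le_add (walkEdgeBound_le hc₂ ht hβ hd.pos γ) ?_) ?_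
  · refine (mul_le_mul (walkTailBound_le hc₁ hα hα' hd.pos n₀ γ)
      (walkEdgeBound_le hc₂ ht hβ hd.pos _) (hedge_nonneg _) (by positivity)).trans_eq (by ring)
  · refine (mul_le_mul_of_nonneg_right (walkTailBound_half_one_add_le hc₁ hα hα' hd.pos hγ hn₀)
      zero_le_two).trans_eq (by ring)

lemma exists_norm_one_sub_backactionFactor_le {c₁ c₂ α β γ t : ℝ} (hc₁ : 0 < c₁) (hc₂ : 0 < c₂)
    (hα : -1 < α) (hα' : α ≤ 1) (hβ : -(1 / 2) < β) (hβ' : β ≤ 0) (hγ : γ < 1) (ht : 0 < t) :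
    ∃ K ≥ 0, ∀ d : ℕ, Odd d → ∀ n₀ : ℤ, |(n₀ : ℝ)| ≤ γ * (d / 2) → ∀ (δ : ℕ → ℝ) (N : ℕ),
      N ≤ t * √d → ‖1 - backactionFactor d (c₁ * (d : ℝ) ^ α) (c₂ * (d : ℝ) ^ β) n₀ δ N‖ ≤
        K * backactionError c₁ c₂ α β γ t n₀ d := by
  have : 0 < 1 - γ := by linarith
  have : 0 < 1 - (1 + γ) / 2 := by linarith
  obtain ⟨K₁, hK₁, h₁⟩ := exists_mul_exp_neg_rpow_le (η := 1 / 2 + β)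
    (show 0 < π * c₂ * (1 - (1 + γ) / 2) ^ 2 / (2 * t) by positivity) (by linarith)
  obtain ⟨K₂, hK₂, h₂⟩ := exists_mul_exp_neg_rpow_le (η := 1 + α)
    (show 0 < π * c₁ * (1 - γ) ^ 2 / 16 by positivity) (by linarith)
  have := theta_pos (s := 1 / c₁) (by positivity) 0
  set A := 4 * Real.exp (π * c₂ / t) with hA
  set B := 2 * Real.exp (π * c₁) * (theta 0 (1 / c₁) / √c₁) with hB
  refine ⟨A + B * (A * K₁ + 2 * K₂), by positivity, fun d hd n₀ hn₀ δ N hN => ?_⟩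
  have hx : (1 : ℝ) ≤ d := by exact_mod_cast hd.pos
  have hbound := norm_one_sub_backactionFactor_rpow_le hc₁ hc₂ hα.le hα' hβ' hγ.le ht hd hn₀ δ hN
  rw [← hA, ← hB] at hbound
  rw [backactionError, Real.rpow_neg_one]
  set X₁ := Real.exp (-(π * c₂ * (1 - γ) ^ 2 / (2 * t)) * (d : ℝ) ^ (1 / 2 + β))
  set X₂ := Real.exp (-(π * c₁ * (γ - 2 * |(n₀ : ℝ)| / d) ^ 2 / 4) * (d : ℝ) ^ (1 + α))
  have hX₁ : X₁ ≤ (d : ℝ) ^ (β / 2 + 1 / 2) * X₁ :=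
    le_mul_of_one_le_left (Real.exp_pos _).le (Real.one_le_rpow hx (by linarith))
  calc _ ≤ _ := hbound
    _ ≤ A * X₁ + B * (A * (K₁ * (d : ℝ)⁻¹) + 2 * (K₂ * (d : ℝ)⁻¹)) * X₂ := by
        gcongr A * X₁ + B * (A * ?_ + 2 * ?_) * X₂
        exacts [h₁ d hx, h₂ d hx]
    _ = A * X₁ + B * (A * K₁ + 2 * K₂) * ((d : ℝ)⁻¹ * X₂) := by ring
    _ ≤ (A + B * (A * K₁ + 2 * K₂)) * ((d : ℝ) ^ (β / 2 + 1 / 2) * X₁) +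
        (A + B * (A * K₁ + 2 * K₂)) * ((d : ℝ)⁻¹ * X₂) := by
        gcongr
        · exact le_add_of_nonneg_right (by positivity)
        · exact le_add_of_nonneg_left (by positivity)
    _ = _ := by ring

lemma abs_sqrt_mul_theta_sub_exp_le {s : ℝ} (hs : 0 < s) {z : ℝ} (hz : |z| ≤ 1 / 2) :
    |√s * theta z s - Real.exp (-(π / s * z ^ 2))| ≤ theta 0 (1 / (4 * s)) - 1 := by
  rw [abs_of_nonneg (sub_nonneg.mpr (exp_neg_sq_le_sqrt_mul_theta hs z))]
  refine hasSum_le (fun m => ?_) ((hasSum_exp_neg_sq_add hs z).sub (hasSum_ite_eq (0 : ℤ) _))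
    ((hasSum_theta_zero (s := 1 / (4 * s)) (by positivity)).sub (hasSum_ite_eq (0 : ℤ) (1 : ℝ)))
  obtain rfl | hm := eq_or_ne m 0
  · simp
  rw [if_neg hm, if_neg hm, sub_zero, sub_zero, Real.exp_le_exp, neg_le_neg_iff]
  have hm₁ : (1 : ℝ) ≤ |(m : ℝ)| := by exact_mod_cast Int.one_le_abs hm
  have hle : |(m : ℝ)| / 2 ≤ |(m : ℝ) + z| := by
    have htriangle := abs_sub_abs_le_abs_sub (m : ℝ) (-z)
    rw [abs_neg, sub_neg_eq_add] at htriangle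
    linarith
  calc π * (1 / (4 * s)) * (m : ℝ) ^ 2 = π / s * (|(m : ℝ)| / 2) ^ 2 := by
        rw [div_pow, sq_abs]; ring
    _ ≤ π / s * |(m : ℝ) + z| ^ 2 := by gcongr
    _ = π / s * (m + z) ^ 2 := by rw [sq_abs]

lemma theta_half_div_theta_zero_le_one {s : ℝ} (hs : 0 < s) : theta (1 / 2) s / theta 0 s ≤ 1 :=
  div_le_one_of_le₀ (theta_le_theta_zero hs _) (theta_pos hs 0).le

lemma one_sub_theta_half_div_theta_zero_le {s : ℝ} (hs : 0 < s) :
    1 - theta (1 / 2) s / theta 0 s ≤ 2 * (theta 0 s - 1) := by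
  have hone := one_le_theta_zero hs
  have habs := abs_le.mp (abs_theta_sub_one_le hs (1 / 2))
  rw [one_sub_div (by linarith), div_le_iff₀ (by linarith)]
  refine le_trans ?_ (le_mul_of_one_le_right (by linarith) hone)
  linarith

/-! ### Asymptotics of the wavefunction factor -/

lemma abs_add_div_add_sub_le {P Q S T v e : ℝ} (hQ : 0 ≤ Q) (hS : 1 ≤ S) (hT : 0 ≤ T)
    (hv : 0 ≤ v) (hv₁ : v ≤ 1) (he : 0 ≤ e) (he₁ : e ≤ 1) :
    |(P * v + Q) / (S + T * v) - e| ≤ |P - e| + Q + |S - 1| + T + (1 - v) := by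
  have hD : 1 ≤ S + T * v := by linarith [mul_nonneg hT hv]
  rw [div_sub' (by linarith), abs_div, abs_of_pos (a := S + T * v) (by linarith)]
  refine (div_le_self (abs_nonneg _) hD).trans ?_
  have hP : |(P - e) * v| ≤ |P - e| := by
    rw [abs_mul, abs_of_nonneg hv]
    exact mul_le_of_le_one_right (abs_nonneg _) hv₁
  have he_mul {x : ℝ} (hx : 0 ≤ x) : 0 ≤ e * x ∧ e * x ≤ x :=
    ⟨mul_nonneg he hx, mul_le_of_le_one_left hx he₁⟩
  have hSe := he_mul (sub_nonneg.mpr hS)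
  have hTe := he_mul (mul_nonneg hT hv)
  have hve := he_mul (sub_nonneg.mpr hv₁)
  have hTv : T * v ≤ T := mul_le_of_le_one_right hT hv₁
  rw [show P * v + Q - (S + T * v) * e =
    (P - e) * v + (Q - e * (S - 1) - e * (T * v) - e * (1 - v)) by ring,
    abs_of_nonneg (sub_nonneg.mpr hS)]
  refine (abs_add_le _ _).trans ?_
  have : |Q - e * (S - 1) - e * (T * v) - e * (1 - v)| ≤ Q + (S - 1) + T + (1 - v) :=
    abs_le.mpr ⟨by linarith, by linarith⟩
  linarith

lemma waveFactor_eq {d : ℕ} (hd : 0 < d) {ξsq : ℝ} (hξ : 0 < ξsq) {s v : ℝ}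
    (hs : s = 1 / (2 * ξsq * d))
    (hv : v = theta (1 / 2) (d / (2 * ξsq)) / theta 0 (d / (2 * ξsq))) :
    waveFactor d ξsq =
      (√s * theta (1 / (2 * d)) s * v + √s * theta (1 / 2 - 1 / (2 * d)) s) /
        (√s * theta 0 s + √s * theta (1 / 2) s * v) := by
  have : (0 : ℝ) < d := by exact_mod_cast hd
  have hsqrt : √s ≠ 0 := by rw [hs]; positivity
  have hθ := (theta_pos (s := d / (2 * ξsq)) (by positivity) 0).ne'
  rw [waveFactor, overlapSum, hv, ← hs]
  field_simp

lemma abs_waveFactor_sub_exp_le {d : ℕ} (hd : 0 < d) {ξsq : ℝ} (hξ : 0 < ξsq) :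
    |waveFactor d ξsq - Real.exp (-(π * ξsq / (2 * d)))| ≤
      4 * (theta 0 (ξsq * d / 2) - 1) +
        2 * Real.exp (-(2 * π * ξsq * d * (1 / 2 - 1 / (2 * d)) ^ 2)) +
        2 * (theta 0 (d / (2 * ξsq)) - 1) := by
  have hx : (1 : ℝ) ≤ d := by exact_mod_cast hd
  have : (0 : ℝ) < d := by linarith
  have hinv : 0 < 1 / (2 * (d : ℝ)) := by positivity
  have hinv' : 1 / (2 * (d : ℝ)) ≤ 1 / 2 := one_div_le_one_div_of_le two_pos (by linarith)
  have hu : 0 < d / (2 * ξsq) := by positivity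
  have hv := div_pos (theta_pos hu (1 / 2)) (theta_pos hu 0)
  have hv₁ := one_sub_theta_half_div_theta_zero_le hu
  rw [waveFactor_eq hd hξ rfl rfl]
  set s := 1 / (2 * ξsq * d) with hs
  have hs₀ : 0 < s := by positivity
  have hgauss {z : ℝ} (hz : |z| ≤ 1 / 2) := abs_sqrt_mul_theta_sub_exp_le hs₀ hz
  rw [show 1 / (4 * s) = ξsq * d / 2 by rw [hs]; field_simp; norm_num,
    show π / s = 2 * π * ξsq * d by rw [hs]; field_simp] at hgauss
  have hpos (z : ℝ) : 0 ≤ √s * theta z s := mul_nonneg (Real.sqrt_nonneg s) (theta_pos hs₀ z).le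
  have hP := hgauss (z := 1 / (2 * d)) (by rwa [abs_of_pos hinv])
  have hQ := hgauss (z := 1 / 2 - 1 / (2 * d)) (by rw [abs_of_nonneg (by linarith)]; linarith)
  have hS := hgauss (z := 0) (by norm_num)
  have hT := hgauss (z := 1 / 2) (by norm_num)
  have hS₁ : 1 ≤ √s * theta 0 s := by simpa using exp_neg_sq_le_sqrt_mul_theta hs₀ 0
  rw [show 2 * π * ξsq * d * (1 / (2 * d)) ^ 2 = π * ξsq / (2 * d) by field_simp] at hP
  rw [show -(2 * π * ξsq * d * (0 : ℝ) ^ 2) = 0 by ring, Real.exp_zero] at hS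
  have hT' : Real.exp (-(2 * π * ξsq * d * (1 / 2) ^ 2)) ≤
      Real.exp (-(2 * π * ξsq * d * (1 / 2 - 1 / (2 * d)) ^ 2)) := by
    gcongr; linarith
  refine (abs_add_div_add_sub_le (hpos _) hS₁ (hpos _) hv.le (theta_half_div_theta_zero_le_one hu)
    (Real.exp_pos _).le (Real.exp_le_one_iff.mpr (neg_nonpos.mpr (by positivity)))).trans ?_
  linarith [(abs_le.mp hQ).2, (abs_le.mp hT).2]

lemma abs_waveFactor_rpow_sub_exp_le {c α : ℝ} (hc : 0 < c) (hα : -1 ≤ α) (hα' : α ≤ 1) {d : ℕ}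
    (hd : 4 ≤ d) :
    |waveFactor d (c * (d : ℝ) ^ α) - Real.exp (-(π * c / 2) * (d : ℝ) ^ (α - 1))| ≤
      (4 * (2 / (1 - Real.exp (-(π * (c / 2))))) + 2) *
          Real.exp (-(9 * π * c / 32) * (d : ℝ) ^ (1 + α)) +
        2 * (2 / (1 - Real.exp (-(π * (1 / (2 * c)))))) *
          Real.exp (-(π / (2 * c)) * (d : ℝ) ^ (1 - α)) := by
  have hx : (4 : ℝ) ≤ d := by exact_mod_cast hd
  have hx₀ : (0 : ℝ) < d := by linarith
  have hk {s : ℝ} (hs : 0 < s) : 0 < 1 - Real.exp (-(π * s)) :=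
    sub_pos.mpr (Real.exp_lt_one_iff.mpr (neg_neg_of_pos (by positivity)))
  have := hk (s := c / 2) (by positivity)
  have hbound := abs_waveFactor_sub_exp_le (ξsq := c * (d : ℝ) ^ α) (by omega : 0 < d)
    (by positivity)
  rw [show π * (c * (d : ℝ) ^ α) / (2 * d) = π * c / 2 * (d : ℝ) ^ (α - 1) by
      rw [Real.rpow_sub hx₀, Real.rpow_one]; field_simp,
    show c * (d : ℝ) ^ α * d / 2 = c / 2 * (d : ℝ) ^ (1 + α) by
      rw [Real.rpow_add hx₀, Real.rpow_one]; ring,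
    show d / (2 * (c * (d : ℝ) ^ α)) = 1 / (2 * c) * (d : ℝ) ^ (1 - α) by
      rw [Real.rpow_sub hx₀, Real.rpow_one]; field_simp,
    show 2 * π * (c * (d : ℝ) ^ α) * d = 2 * π * c * (d : ℝ) ^ (1 + α) by
      rw [Real.rpow_add hx₀, Real.rpow_one]; ring, ← neg_mul] at hbound
  have hy := Real.one_le_rpow (show (1 : ℝ) ≤ d by linarith) (show 0 ≤ 1 + α by linarith)
  have hy' := Real.one_le_rpow (show (1 : ℝ) ≤ d by linarith) (show 0 ≤ 1 - α by linarith)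
  set y := (d : ℝ) ^ (1 + α)
  set y' := (d : ℝ) ^ (1 - α)
  have hθ := theta_zero_sub_one_le (s₀ := c / 2) (by positivity)
    (le_mul_of_one_le_right (by positivity) hy)
  have hθ' := theta_zero_sub_one_le (s₀ := 1 / (2 * c)) (by positivity)
    (le_mul_of_one_le_right (by positivity) hy')
  have hexp : Real.exp (-(π * (c / 2 * y))) ≤ Real.exp (-(9 * π * c / 32) * y) := by
    rw [Real.exp_le_exp]
    linarith [show 0 ≤ π * c * y by positivity]
  have hmid : Real.exp (-(2 * π * c * y * (1 / 2 - 1 / (2 * d)) ^ 2)) ≤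
      Real.exp (-(9 * π * c / 32) * y) := by
    have hinv : 1 / (2 * (d : ℝ)) ≤ 1 / 8 :=
      one_div_le_one_div_of_le (by norm_num) (by linarith)
    have hsq : (3 / 8 : ℝ) ^ 2 ≤ (1 / 2 - 1 / (2 * d)) ^ 2 := by gcongr; linarith
    rw [Real.exp_le_exp]
    linarith [mul_le_mul_of_nonneg_left hsq (show 0 ≤ 2 * π * c * y by positivity)]
  have hθ₂ := hθ.trans (mul_le_mul_of_nonneg_left hexp (by positivity))
  rw [show -(π * (1 / (2 * c) * y')) = -(π / (2 * c)) * y' by ring] at hθ'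
  linarith

lemma exists_abs_waveFactor_div_sub_one_le {c α : ℝ} (hc : 0 < c) (hα : -1 < α) (hα' : α ≤ 1) :
    ∃ K ≥ 0, ∀ d : ℕ, 4 ≤ d →
      |waveFactor d (c * (d : ℝ) ^ α) / Real.exp (-(π * c / 2) * (d : ℝ) ^ (α - 1)) - 1| ≤
        K * ((d : ℝ)⁻¹ * Real.exp (-(π * c / 4) * (d : ℝ) ^ (1 + α)) +
          Real.exp (-(π / (2 * c)) * (d : ℝ) ^ (1 - α))) := by
  obtain ⟨K, hK, h⟩ := exists_mul_exp_neg_rpow_le (κ := π * c / 32) (η := 1 + α)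
    (by positivity) (by linarith)
  have hk {s : ℝ} (hs : 0 < s) : 0 < 2 / (1 - Real.exp (-(π * s))) :=
    div_pos two_pos (sub_pos.mpr (Real.exp_lt_one_iff.mpr (neg_neg_of_pos (by positivity))))
  have := hk (s := c / 2) (by positivity)
  have := hk (s := 1 / (2 * c)) (by positivity)
  set k := 2 / (1 - Real.exp (-(π * (c / 2)))) with hk_def
  set k' := 2 / (1 - Real.exp (-(π * (1 / (2 * c))))) with hk_def'
  refine ⟨((4 * k + 2) * K + 2 * k') * Real.exp (π * c / 2), by positivity, fun d hd => ?_⟩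
  have hx : (1 : ℝ) ≤ d := by norm_cast; omega
  have hw : (d : ℝ) ^ (α - 1) ≤ 1 := Real.rpow_le_one_of_one_le_of_nonpos hx (by linarith)
  have hbound := abs_waveFactor_rpow_sub_exp_le hc hα.le hα' hd
  rw [← hk_def, ← hk_def'] at hbound
  set w := Real.exp (-(π * c / 2) * (d : ℝ) ^ (α - 1)) with hw_def
  have hw₀ : 0 < w := Real.exp_pos _
  have hw_inv : 1 ≤ Real.exp (π * c / 2) * w := by
    rw [hw_def, ← Real.exp_add, Real.one_le_exp_iff]
    linarith [mul_le_mul_of_nonneg_left hw (show 0 ≤ π * c / 2 by positivity)]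
  have hsplit : Real.exp (-(9 * π * c / 32) * (d : ℝ) ^ (1 + α)) ≤
      K * ((d : ℝ)⁻¹ * Real.exp (-(π * c / 4) * (d : ℝ) ^ (1 + α))) := by
    have := (le_mul_of_one_le_left (Real.exp_pos _).le hx).trans (h d hx)
    calc _ = Real.exp (-(π * c / 32) * (d : ℝ) ^ (1 + α)) *
          Real.exp (-(π * c / 4) * (d : ℝ) ^ (1 + α)) := by rw [← Real.exp_add]; ring_nf
      _ ≤ K * (d : ℝ)⁻¹ * Real.exp (-(π * c / 4) * (d : ℝ) ^ (1 + α)) := by gcongr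
      _ = _ := mul_assoc _ _ _
  set q := (d : ℝ)⁻¹ * Real.exp (-(π * c / 4) * (d : ℝ) ^ (1 + α))
  set n := Real.exp (-(π / (2 * c)) * (d : ℝ) ^ (1 - α))
  rw [div_sub_one hw₀.ne', abs_div, abs_of_pos hw₀, div_le_iff₀ hw₀]
  calc _ ≤ _ := hbound
    _ ≤ (4 * k + 2) * (K * q) + 2 * k' * n := by gcongr
    _ ≤ ((4 * k + 2) * K + 2 * k') * (q + n) := by
        have : 0 ≤ (4 * k + 2) * K * n + 2 * k' * q := by positivity
        linarith
    _ ≤ ((4 * k + 2) * K + 2 * k') * (q + n) * (Real.exp (π * c / 2) * w) :=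
        le_mul_of_one_le_right (by positivity) hw_inv
    _ = _ := by ring

/-! ### Asymptotics of the imprecision factor -/

lemma imprecisionFactor_eq {d : ℕ} (hd : 0 < d) {σsq : ℝ} (hσ : 0 < σsq) :
    imprecisionFactor d σsq = ((Real.exp (-(π * σsq / (2 * d))) *
      (theta (1 / 2) (d / (2 * σsq)) / theta 0 (d / (2 * σsq))) : ℝ) : ℂ) := by
  have : (0 : ℝ) < d := by exact_mod_cast hd
  have hs : 0 < d / (2 * σsq) := by positivity
  have hkraus (m : ℤ) : krausProd d σsq 1 m = Real.exp (-(π * σsq / (2 * d))) *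
      Real.exp (-(π / (d / (2 * σsq)) * (m + -(1 / 2)) ^ 2)) / theta 0 (2 * σsq / d) := by
    rw [krausProd, gauss, gauss, ← Real.exp_add, ← Real.exp_add]
    congr 2
    push_cast
    field_simp
    ring
  rw [← tsum_krausProd_one hd hσ]
  simp only [hkraus]
  rw [tsum_div_const, tsum_mul_left, (hasSum_exp_neg_sq_add hs _).tsum_eq, theta_neg,
    ← one_div_div (d : ℝ), ← sqrt_mul_theta_zero hs, mul_div_assoc,
    mul_div_mul_left _ _ (Real.sqrt_pos.mpr hs).ne']

lemma imprecisionFactor_rpow_div_exp {c β : ℝ} (hc : 0 < c) {d : ℕ} (hd : 0 < d) :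
    imprecisionFactor d (c * (d : ℝ) ^ β) /
        (Real.exp (-(π * c / 2) * (d : ℝ) ^ (β - 1)) : ℝ) =
      ((theta (1 / 2) (1 / (2 * c) * (d : ℝ) ^ (1 - β)) /
        theta 0 (1 / (2 * c) * (d : ℝ) ^ (1 - β)) : ℝ) : ℂ) := by
  have hx₀ : (0 : ℝ) < d := by exact_mod_cast hd
  rw [imprecisionFactor_eq hd (by positivity),
    show π * (c * (d : ℝ) ^ β) / (2 * d) = π * c / 2 * (d : ℝ) ^ (β - 1) by
      rw [Real.rpow_sub hx₀, Real.rpow_one]; field_simp,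
    show d / (2 * (c * (d : ℝ) ^ β)) = 1 / (2 * c) * (d : ℝ) ^ (1 - β) by
      rw [Real.rpow_sub hx₀, Real.rpow_one]; field_simp,
    ← Complex.ofReal_div, neg_mul, mul_div_cancel_left₀ _ (Real.exp_pos _).ne']

lemma norm_imprecisionFactor_rpow_div_exp_le_one {c β : ℝ} (hc : 0 < c) {d : ℕ} (hd : 0 < d) :
    ‖imprecisionFactor d (c * (d : ℝ) ^ β) /
        (Real.exp (-(π * c / 2) * (d : ℝ) ^ (β - 1)) : ℝ)‖ ≤ 1 := by
  have : (0 : ℝ) < d := by exact_mod_cast hd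
  have hu : 0 < 1 / (2 * c) * (d : ℝ) ^ (1 - β) := by positivity
  rw [imprecisionFactor_rpow_div_exp hc hd, Complex.norm_real,
    Real.norm_of_nonneg (div_pos (theta_pos hu _) (theta_pos hu _)).le]
  exact theta_half_div_theta_zero_le_one hu

lemma exists_mul_rpow_le_add_mul {p κ β : ℝ} (hp : 0 < p) (hκ : 0 ≤ κ) (hβ : β ≤ 0) :
    ∃ A : ℝ, ∀ y : ℝ, 1 ≤ y → κ * y ^ (1 / 2 + β) ≤ A + p * y ^ (1 - β) := by
  refine ⟨κ ^ 2 / (4 * p), fun y hy => ?_⟩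
  calc κ * y ^ (1 / 2 + β) ≤ κ * √y := by
        rw [Real.sqrt_eq_rpow]
        gcongr κ * y ^ ?_
        linarith
    _ ≤ κ ^ 2 / (4 * p) + p * √y ^ 2 := by
        have : 0 ≤ (κ - 2 * p * √y) ^ 2 / (4 * p) := by positivity
        have : (κ - 2 * p * √y) ^ 2 / (4 * p) = κ ^ 2 / (4 * p) + p * √y ^ 2 - κ * √y := by
          field_simp
          ring
        linarith
    _ ≤ κ ^ 2 / (4 * p) + p * y ^ (1 - β) := by
        rw [Real.sq_sqrt (by linarith)]
        gcongr
        exact Real.self_le_rpow_of_one_le hy (by linarith)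

lemma exists_norm_imprecisionFactor_div_sub_one_le {c β κ : ℝ} (hc : 0 < c) (hβ : β ≤ 0)
    (hκ : 0 ≤ κ) :
    ∃ K ≥ 0, ∀ d : ℕ, 0 < d →
      ‖imprecisionFactor d (c * (d : ℝ) ^ β) /
        (Real.exp (-(π * c / 2) * (d : ℝ) ^ (β - 1)) : ℝ) - 1‖ ≤
          K * Real.exp (-κ * (d : ℝ) ^ (1 / 2 + β)) := by
  obtain ⟨A, hA⟩ :=
    exists_mul_rpow_le_add_mul (show 0 < π * (1 / (2 * c)) by positivity) hκ hβ
  have hden : 0 < 1 - Real.exp (-(π * (1 / (2 * c)))) := by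
    rw [sub_pos, Real.exp_lt_one_iff, neg_lt_zero]
    positivity
  refine ⟨2 * (2 / (1 - Real.exp (-(π * (1 / (2 * c)))))) * Real.exp A, by positivity,
    fun d hd => ?_⟩
  have hx : (1 : ℝ) ≤ d := by exact_mod_cast hd
  set s := 1 / (2 * c) * (d : ℝ) ^ (1 - β)
  have hs : 0 < s := by positivity
  have hs₀ : 1 / (2 * c) ≤ s :=
    le_mul_of_one_le_right (by positivity) (Real.one_le_rpow hx (by linarith))
  rw [imprecisionFactor_rpow_div_exp hc hd, ← Complex.ofReal_one, ← Complex.ofReal_sub,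
    Complex.norm_real, Real.norm_eq_abs, abs_sub_comm,
    abs_of_nonneg (sub_nonneg.mpr (theta_half_div_theta_zero_le_one hs))]
  calc 1 - theta (1 / 2) s / theta 0 s ≤ 2 * (theta 0 s - 1) :=
        one_sub_theta_half_div_theta_zero_le hs
    _ ≤ 2 * (2 / (1 - Real.exp (-(π * (1 / (2 * c))))) * Real.exp (-(π * s))) := by
        gcongr
        exact theta_zero_sub_one_le (by positivity) hs₀
    _ ≤ 2 * (2 / (1 - Real.exp (-(π * (1 / (2 * c))))) *
          Real.exp (A + -κ * (d : ℝ) ^ (1 / 2 + β))) := by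
        gcongr
        linarith [hA d hx]
    _ = _ := by rw [Real.exp_add]; ring

/-! ### Combining the factors -/

lemma norm_backactionFactor_le_one {d : ℕ} (hd : Odd d) {ξsq σsq : ℝ} (hξ : 0 < ξsq)
    (hσ : 0 < σsq) (n₀ : ℤ) (δ : ℕ → ℝ) (N : ℕ) : ‖backactionFactor d ξsq σsq n₀ δ N‖ ≤ 1 := by
  rw [backactionFactor_eq_sum]
  exact norm_sum_mul_le_one (walkInitial_nonneg hd.pos hξ n₀) (sum_walkInitial hd hξ n₀)
    (norm_backactionWeight_le_one hd hσ δ N)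

lemma norm_mul_mul_sub_one_le {a b c : ℂ} (hb : ‖b‖ ≤ 1) (hc : ‖c‖ ≤ 1) :
    ‖a * b * c - 1‖ ≤ ‖a - 1‖ + ‖b - 1‖ + ‖c - 1‖ := by
  rw [show a * b * c - 1 = (a - 1) * (b * c) + (b - 1) * c + (c - 1) by ring]
  refine norm_add₃_le.trans ?_
  rw [norm_mul, norm_mul, norm_mul]
  gcongr
  · exact mul_le_of_le_one_right (norm_nonneg _) (mul_le_one₀ hb (norm_nonneg _) hc)
  · exact mul_le_of_le_one_right (norm_nonneg _) hc

lemma exp_phase_eq_fourierChar (d I : ℕ) (δ : ℕ → ℝ) :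
    Complex.exp (-(2 * π * Complex.I / d * ∑ j ∈ Finset.Icc 1 I, (δ j : ℂ))) =
      𝐞 (-((∑ j ∈ Finset.Icc 1 I, δ j) / d)) := by
  rw [Real.fourierChar_apply]
  push_cast
  ring_nf

lemma exp_le_backactionError (c₁ c₂ α γ t : ℝ) {β : ℝ} (hβ : -1 ≤ β) (n₀ : ℤ) {d : ℕ}
    (hd : 0 < d) :
    Real.exp (-(π * c₂ * (1 - γ) ^ 2 / (2 * t)) * (d : ℝ) ^ (1 / 2 + β)) ≤
      backactionError c₁ c₂ α β γ t n₀ d := by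
  have hx : (1 : ℝ) ≤ d := by exact_mod_cast hd
  have hpow : 1 ≤ (d : ℝ) ^ (β / 2 + 1 / 2) := Real.one_le_rpow hx (by linarith)
  exact (le_mul_of_one_le_left (Real.exp_pos _).le hpow).trans
    (le_add_of_nonneg_right (by positivity))

lemma inv_mul_exp_le_backactionError {c₁ : ℝ} (hc₁ : 0 ≤ c₁) (c₂ α β t : ℝ) {γ : ℝ} (hγ : γ ≤ 1)
    {n₀ : ℤ} {d : ℕ} (hd : 0 < d) (hn₀ : |(n₀ : ℝ)| ≤ γ * (d / 2)) :
    (d : ℝ)⁻¹ * Real.exp (-(π * c₁ / 4) * (d : ℝ) ^ (1 + α)) ≤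
      backactionError c₁ c₂ α β γ t n₀ d := by
  have hx₀ : (0 : ℝ) < d := by exact_mod_cast hd
  have hle : 2 * |(n₀ : ℝ)| / d ≤ γ := by rw [div_le_iff₀ hx₀]; linarith
  have hsq : (γ - 2 * |(n₀ : ℝ)| / d) ^ 2 ≤ 1 := by
    have : 0 ≤ 2 * |(n₀ : ℝ)| / d := by positivity
    exact pow_le_one₀ (by linarith) (by linarith)
  rw [backactionError, Real.rpow_neg_one]
  refine le_add_of_nonneg_of_le (by positivity) ?_
  gcongr (d : ℝ)⁻¹ * Real.exp (-?_ * _)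
  rw [mul_div_right_comm]
  exact mul_le_of_le_one_right (by positivity) hsq

lemma backactionError_nonneg (c₁ c₂ α β γ t : ℝ) (n₀ : ℤ) (d : ℕ) :
    0 ≤ backactionError c₁ c₂ α β γ t n₀ d := by
  rw [backactionError]
  positivity

lemma exists_norm_factors_div_exp_sub_one_le {c₁ c₂ α β γ t : ℝ} (hc₁ : 0 < c₁) (hc₂ : 0 < c₂)
    (hα : -1 < α) (hα' : α ≤ 1) (hβ : -(1 / 2) < β) (hβ' : β ≤ 0) (hγ : γ < 1) (ht : 0 < t) :
    ∃ K ≥ 0, ∀ d : ℕ, Odd d → 4 ≤ d → ∀ n₀ : ℤ, |(n₀ : ℝ)| ≤ γ * (d / 2) →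
      ∀ (δ : ℕ → ℝ) (N : ℕ), N ≤ t * √d →
        ‖((waveFactor d (c₁ * (d : ℝ) ^ α) /
              Real.exp (-(π * c₁ / 2) * (d : ℝ) ^ (α - 1)) : ℝ) : ℂ) *
            (imprecisionFactor d (c₂ * (d : ℝ) ^ β) /
              (Real.exp (-(π * c₂ / 2) * (d : ℝ) ^ (β - 1)) : ℝ)) *
            backactionFactor d (c₁ * (d : ℝ) ^ α) (c₂ * (d : ℝ) ^ β) n₀ δ N - 1‖ ≤
          K * (backactionError c₁ c₂ α β γ t n₀ d +
            Real.exp (-(π / (2 * c₁)) * (d : ℝ) ^ (1 - α))) := by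
  obtain ⟨K₁, hK₁, h₁⟩ := exists_abs_waveFactor_div_sub_one_le hc₁ hα hα'
  obtain ⟨K₂, hK₂, h₂⟩ := exists_norm_imprecisionFactor_div_sub_one_le hc₂ hβ'
    (show 0 ≤ π * c₂ * (1 - γ) ^ 2 / (2 * t) by positivity)
  obtain ⟨K₃, hK₃, h₃⟩ := exists_norm_one_sub_backactionFactor_le hc₁ hc₂ hα hα' hβ hβ' hγ ht
  refine ⟨K₁ + K₂ + K₃, by positivity, fun d hd hd₄ n₀ hn₀ δ N hN => ?_⟩
  have : (0 : ℝ) < d := by exact_mod_cast hd.pos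
  have hE := inv_mul_exp_le_backactionError hc₁.le c₂ α β t hγ.le hd.pos hn₀
  have hE' := exp_le_backactionError c₁ c₂ α γ t (by linarith : -1 ≤ β) n₀ hd.pos
  set E := backactionError c₁ c₂ α β γ t n₀ d
  set X := Real.exp (-(π / (2 * c₁)) * (d : ℝ) ^ (1 - α))
  have hX : 0 ≤ X := (Real.exp_pos _).le
  refine (norm_mul_mul_sub_one_le (norm_imprecisionFactor_rpow_div_exp_le_one hc₂ hd.pos)
    (norm_backactionFactor_le_one hd (by positivity) (by positivity) n₀ δ N)).trans ?_
  rw [← Complex.ofReal_one, ← Complex.ofReal_sub, Complex.norm_real, Complex.ofReal_one,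
    Real.norm_eq_abs, norm_sub_rev (backactionFactor _ _ _ _ _ _)]
  calc _ ≤ K₁ * (E + X) + K₂ * E + K₃ * E := by
        gcongr
        · exact (h₁ d hd₄).trans (by gcongr)
        · exact (h₂ d hd.pos).trans (by gcongr)
        · exact h₃ d hd n₀ hn₀ δ N hN
    _ ≤ (K₁ + K₂ + K₃) * (E + X) := by linarith [mul_nonneg hK₂ hX, mul_nonneg hK₃ hX]

end QuasiIdealClock

end

open QuasiIdealClock in
theorem mainTheorem1_general (c₁ c₂ α β γ t : ℝ) (hc₁ : 0 < c₁) (hc₂ : 0 < c₂)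
    (hα : -1 < α) (hα' : α ≤ 1) (hβ : -(1 / 2) < β) (hβ' : β ≤ 0) (hγ : γ < 1) (ht : 0 < t) :
    ∃ C : ℝ, ∀ d : ℕ, Odd d → 4 ≤ d →
      ∀ n₀ : ℤ, |(n₀ : ℝ)| ≤ γ * ((d : ℝ) / 2) →
      ∀ (δ : ℕ → ℝ) (I J : ℕ) (_ : 1 ≤ I) (_ : (I : ℝ) ≤ t * Real.sqrt d) (_ : I ≤ J),
        let ξsq : ℝ := c₁ * (d : ℝ) ^ α
        let σsq : ℝ := c₂ * (d : ℝ) ^ β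
        let moment : ℂ := clockMoment d ξsq σsq n₀ δ J ⟨I - 1, by omega⟩
        let phase : ℂ :=
          Complex.exp (-(2 * Real.pi * Complex.I / (d : ℂ) * ∑ j ∈ Finset.Icc 1 I, (δ j : ℂ)))
        let C₃ : ℂ := backactionFactor d ξsq σsq n₀ δ (I - 1)
        (∃ ε : ℂ,
          ‖ε‖ ≤ C * (backactionError c₁ c₂ α β γ t n₀ d +
            Real.exp (-(Real.pi / (2 * c₁)) * (d : ℝ) ^ (1 - α))) ∧
          moment = phase *
            ((Real.exp (-(Real.pi * c₁ / 2) * (d : ℝ) ^ (α - 1) -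
              Real.pi * c₂ / 2 * (d : ℝ) ^ (β - 1)) : ℝ) : ℂ) * (1 + ε)) ∧
        moment = phase * (waveFactor d ξsq : ℂ) * imprecisionFactor d σsq * C₃ ∧
        ‖C₃ - 1‖ ≤ C * backactionError c₁ c₂ α β γ t n₀ d := by
  obtain ⟨K, hK, h⟩ := exists_norm_factors_div_exp_sub_one_le hc₁ hc₂ hα hα' hβ hβ' hγ ht
  obtain ⟨K₃, hK₃, h₃⟩ := exists_norm_one_sub_backactionFactor_le hc₁ hc₂ hα hα' hβ hβ' hγ ht
  refine ⟨K + K₃, fun d hd hd₄ n₀ hn₀ δ I J hI hIt hIJ => ?_⟩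
  intro ξsq σsq moment phase C₃
  have : (0 : ℝ) < d := by exact_mod_cast hd.pos
  have hN : ((I - 1 : ℕ) : ℝ) ≤ t * Real.sqrt d := (Nat.cast_le.mpr (Nat.sub_le I 1)).trans hIt
  have hE := backactionError_nonneg c₁ c₂ α β γ t n₀ d
  have hmoment : moment = phase * waveFactor d ξsq * imprecisionFactor d σsq * C₃ := by
    have := clockMoment_eq hd (ξsq := ξsq) (σsq := σsq) (by positivity) (by positivity) n₀ δ
      (⟨I - 1, by omega⟩ : Fin J)
    rwa [Nat.sub_add_cancel hI, ← exp_phase_eq_fourierChar] at this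
  refine ⟨⟨_, (h d hd hd₄ n₀ hn₀ δ (I - 1) hN).trans ?_, ?_⟩, hmoment, ?_⟩
  · gcongr
    exact le_add_of_nonneg_right hK₃
  · rw [hmoment, add_sub_cancel, sub_eq_add_neg, ← neg_mul, Real.exp_add]
    push_cast
    field_simp
    rfl
  · rw [norm_sub_rev]
    refine (h₃ d hd n₀ hn₀ δ (I - 1) hN).trans ?_
    gcongr
    exact le_add_of_nonneg_left hK

theorem mainTheorem1 (c₁ c₂ α β γ t : ℝ) (hc₁ : 0 < c₁) (hc₂ : 0 < c₂)
    (hα : -1 < α) (hα' : α < 1) (hβ : -(1 / 2) < β) (hβ' : β < 0)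
    (hγ : 1 / 2 < γ) (hγ' : γ < 1) (ht : 0 < t) :
    ∃ C : ℝ, ∃ d₀ : ℕ, ∀ d : ℕ, Odd d → d₀ ≤ d →
      ∀ n₀ : ℤ, |(n₀ : ℝ)| < γ * ((d : ℝ) / 2) - 1 / 2 →
      ∀ (I J : ℕ) (_ : 2 ≤ I) (_ : (I : ℝ) ≤ t * Real.sqrt d) (_ : I ≤ J),
        let ξsq : ℝ := c₁ * (d : ℝ) ^ α
        let σsq : ℝ := c₂ * (d : ℝ) ^ β
        let δ : ℕ → ℝ := fun _ => 1 / 2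
        let moment : ℂ := QuasiIdealClock.clockMoment d ξsq σsq n₀ δ J ⟨I - 1, by omega⟩
        let phase : ℂ :=
          Complex.exp (-(2 * Real.pi * Complex.I / (d : ℂ) * ∑ j ∈ Finset.Icc 1 I, (δ j : ℂ)))
        let C₃ : ℂ := QuasiIdealClock.backactionFactor d ξsq σsq n₀ δ (I - 1)
        (∃ ε : ℂ,
          ‖ε‖ ≤ C * (QuasiIdealClock.backactionError c₁ c₂ α β γ t n₀ d +
            Real.exp (-(Real.pi / (2 * c₁)) * (d : ℝ) ^ (1 - α))) ∧
          moment = phase *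
            ((Real.exp (-(Real.pi * c₁ / 2) * (d : ℝ) ^ (α - 1) -
              Real.pi * c₂ / 2 * (d : ℝ) ^ (β - 1)) : ℝ) : ℂ) * (1 + ε)) ∧
        moment = phase * (QuasiIdealClock.waveFactor d ξsq : ℂ) *
          QuasiIdealClock.imprecisionFactor d σsq * C₃ ∧
        ‖C₃ - 1‖ ≤ C * QuasiIdealClock.backactionError c₁ c₂ α β γ t n₀ d := by
  obtain ⟨C, h⟩ :=
    mainTheorem1_general c₁ c₂ α β γ t hc₁ hc₂ hα hα'.le hβ hβ'.le hγ' ht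
  exact ⟨C, 4, fun d hd hd₄ n₀ hn₀ I J hI hIt hIJ =>
    h d hd hd₄ n₀ (by linarith) (fun _ => 1 / 2) I J (by omega) hIt hIJ⟩
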